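/- **Notation.** For $u\in C_c^\infty(\mathbb{R})$ let $\check u(t)=\frac1{2\pi}\int_{\mathbb{R}}u(\xi)e^{i\xi t}\,d\xi$, and write $\langle n\rangle=1+|n|$. Fix complex-valued smooth, compactly supported functions as follows. * An equidistant partition of unity: $\phi\in C_c^\infty(\mathbb{R})$ with $\operatorname{supp}\phi\subset[-1,1]$ and $\phi_n=\phi(\cdot-n)$ such that $\sum_{n\in\mathbb{Z}}\phi_n(t)=1$ for all $t\in\mathbb{R}$. * A dyadic partition of unity: $\varphi=\varphi_0\in C_c^\infty(\mathbb{R})$ with $\operatorname{supp}\varphi\subset[\frac12,2]$ and $\sum_{n\in\mathbb{Z}}\varphi(2^{-n}t)=1$ for all $t>0$. * A dyadic Fourier partition of unity: $\psi_0,\psi_1\in C_c^\infty(\mathbb{R})$ with $\operatorname{supp}\psi_0\subset[-1,1]$, $\operatorname{supp}\psi_1\subset[\frac12,2]$, $\psi_n=\psi_1(2^{1-n}\cdot)$ for $n\ge2$, $\psi_n=\psi_{-n}(-\,\cdot)$ for $n\le-1$, and $\sum_{n\in\mathbb{Z}}\psi_n(t)=1$ for all $t\in\mathbb{R}$. For $\beta\in\mathbb{R}$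 let $\mathcal{M}^\beta$ be the class of functions $f:(0,\infty)\to\mathbb{C}$ such that $f_e(x)=f(e^x)$ is bounded and continuous on $\mathbb{R}$ and $$\|f\|_{\mathcal{M}^\beta}=\sum_{n\in\mathbb{Z}}2^{|n|\beta}\,\|f_e*\check\psi_n\|_\infty<\infty .$$ For $\alpha>0$ let $E^\alpha_{\mathrm{unif}}$ be the class of locally integrable functions $f:(0,\infty)\to\mathbb{C}$, identified when they agree almost everywhere, such that $$\|f\|_{E^\alpha_{\mathrm{unif}}}=\sum_{n\in\mathbb{Z}}\langle n\rangle^\alpha\sup_{k\in\mathbb{Z}}\big\|[f(2^k\cdot)\varphi_0]*\check\phi_n\big\|_\infty<\infty .$$ **Proposition.** Let $\alpha>0$ and $\varepsilon>0$. Then there are continuous embeddings $$\mathcal{M}^{\alpha+1+\varepsilon}\hookrightarrow E^\alpha_{\mathrm{unif}}\hookrightarrow\mathcal{M}^{\alpha-\varepsilon}.$$ That is, there is a constant $C<\infty$, depending only on $\alpha$, $\varepsilon$ and the chosen partitions of unity, such that 1. every $f\in\mathcal{M}^{\alpha+1+\varepsilon}$ belongs to $E^\alpha_{\mathrm{unif}}$,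 and $\|f\|_{E^\alpha_{\mathrm{unif}}}\le C\,\|f\|_{\mathcal{M}^{\alpha+1+\varepsilon}}$; 2. every $f\in E^\alpha_{\mathrm{unif}}$ agrees almost everywhere on $(0,\infty)$ with a function $g\in\mathcal{M}^{\alpha-\varepsilon}$, and $\|g\|_{\mathcal{M}^{\alpha-\varepsilon}}\le C\,\|f\|_{E^\alpha_{\mathrm{unif}}}$. -/

import Mathlib

open MeasureTheory Set
open scoped ENNReal NNReal ContDiff

noncomputable section

namespace Multiplier

/-- `φ` generates an equidistant partition of unity `φ_n = φ(· - n)`, `n ∈ ℤ`. -/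
structure IsEquidistantPartition (φ : ℝ → ℂ) : Prop where
  smooth : ContDiff ℝ ∞ φ
  support : tsupport φ ⊆ Icc (-1) 1
  sum_eq_one : ∀ t : ℝ, HasSum (fun n : ℤ => φ (t - n)) 1

/-- `η` generates a dyadic partition of unity `η_n = η(2⁻ⁿ ·)`, `n ∈ ℤ`, of `(0, ∞)`. -/
structure IsDyadicPartition (η : ℝ → ℂ) : Prop where
  smooth : ContDiff ℝ ∞ η
  support : tsupport η ⊆ Icc (1 / 2) 2
  sum_eq_one : ∀ t : ℝ, 0 < t → HasSum (fun n : ℤ => η ((2 : ℝ) ^ (-n) * t)) 1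

/-- `(ψ_n)_{n ∈ ℤ}` is a dyadic Fourier partition of unity of `ℝ`. -/
structure IsDyadicFourierPartition (ψ : ℤ → ℝ → ℂ) : Prop where
  smooth_zero : ContDiff ℝ ∞ (ψ 0)
  smooth_one : ContDiff ℝ ∞ (ψ 1)
  support_zero : tsupport (ψ 0) ⊆ Icc (-1) 1
  support_one : tsupport (ψ 1) ⊆ Icc (1 / 2) 2
  dilate : ∀ n : ℤ, 2 ≤ n → ∀ t : ℝ, ψ n t = ψ 1 ((2 : ℝ) ^ (1 - n) * t)
  reflect : ∀ n : ℤ, n ≤ -1 → ∀ t : ℝ, ψ n t = ψ (-n) (-t)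
  sum_eq_one : ∀ t : ℝ, HasSum (fun n : ℤ => ψ n t) 1

/-- The inverse Fourier transform `u ↦ ǔ`, `ǔ(t) = (2π)⁻¹ ∫ u(ξ) e^{iξt} dξ`. -/
def check (u : ℝ → ℂ) (t : ℝ) : ℂ :=
  (2 * (Real.pi : ℂ))⁻¹ * ∫ ξ : ℝ, Complex.exp (Complex.I * ξ * t) * u ξ

/-- `check` is Mathlib's inverse Fourier transform in the angular-frequency normalisation. -/
theorem check_eq_fourierInv (u : ℝ → ℂ) (t : ℝ) :
    check u t = (2 * (Real.pi : ℂ))⁻¹ * FourierTransformInv.fourierInv u (t / (2 * Real.pi)) := by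
  unfold check
  rw [Real.fourierInv_eq']
  congr 1
  refine integral_congr_ae (Filter.Eventually.of_forall fun ξ => ?_)
  simp only [smul_eq_mul]
  congr 2
  have h : (Real.pi : ℂ) ≠ 0 := by exact_mod_cast Real.pi_ne_zero
  simp
  field_simp

/-- The convolution `h ∗ ǔ` on `ℝ`. -/
def convCheck (h u : ℝ → ℂ) : ℝ → ℂ :=
  convolution h (check u) (ContinuousLinearMap.mul ℂ ℂ) volume

/-- The supremum norm `‖h‖_∞`, with values in `[0, ∞]`. -/
def supNorm (h : ℝ → ℂ) : ℝ≥0∞ := ⨆ x : ℝ, ‖h x‖ₑ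

/-- The `B^β_{∞,1}` norm `∑_{n ∈ ℤ} 2^{|n|β} ‖h ∗ ψ̌_n‖_∞`. -/
def besovNorm (ψ : ℤ → ℝ → ℂ) (β : ℝ) (h : ℝ → ℂ) : ℝ≥0∞ :=
  ∑' n : ℤ, ENNReal.ofReal ((2 : ℝ) ^ (|(n : ℝ)| * β)) * supNorm (convCheck h (ψ n))

/-- The Besov space `B^β_{∞,1}`: bounded continuous functions on `ℝ` of finite Besov norm. -/
def besovSpace (ψ : ℤ → ℝ → ℂ) (β : ℝ) : Set (ℝ → ℂ) :=
  {h | Continuous h ∧ (∃ K : ℝ, ∀ x, ‖h x‖ ≤ K) ∧ besovNorm ψ β h < (⊤ : ℝ≥0∞)}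

/- A function `f : (0, ∞) → ℂ` is represented by a function `f : ℝ → ℂ`; its values on `(-∞, 0]`
do not enter any of the definitions below. -/

/-- `f_e(x) = f(eˣ)`, for a function `f` on `(0, ∞)`. -/
def expComp (f : ℝ → ℂ) : ℝ → ℂ := fun x => f (Real.exp x)

/-- The Mihlin norm `‖f‖_{M^β} = ‖f_e‖_{B^β_{∞,1}}`. -/
def mihlinNorm (ψ : ℤ → ℝ → ℂ) (β : ℝ) (f : ℝ → ℂ) : ℝ≥0∞ :=
  besovNorm ψ β (expComp f)

/-- The Mihlin class `M^β`: functions `f` on `(0, ∞)` with `f_e ∈ B^β_{∞,1}`. -/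
def mihlinClass (ψ : ℤ → ℝ → ℂ) (β : ℝ) : Set (ℝ → ℂ) :=
  {f | expComp f ∈ besovSpace ψ β}

/-- The localised dilate `f(2ᵏ ·) η_0`. As `η = η_0` is supported in `[1/2, 2]`, this only involves
the values of `f` on `(0, ∞)`. -/
def localDilate (η : ℝ → ℂ) (f : ℝ → ℂ) (k : ℤ) : ℝ → ℂ :=
  fun t => f ((2 : ℝ) ^ k * t) * η t

/-- The norm `∑_{n ∈ ℤ} ⟨n⟩^α sup_{k ∈ ℤ} ‖[f(2ᵏ ·) η_0] ∗ φ̌_n‖_∞`, `⟨n⟩ = 1 + |n|`,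
of `E^α_unif`. -/
def eUnifNorm (φ η : ℝ → ℂ) (α : ℝ) (f : ℝ → ℂ) : ℝ≥0∞ :=
  ∑' n : ℤ, ENNReal.ofReal ((1 + |(n : ℝ)|) ^ α) *
    ⨆ k : ℤ, supNorm (convCheck (localDilate η f k) (fun t => φ (t - n)))

/-- The class `E^α_unif`: locally integrable functions on `(0, ∞)` (so that the convolutions in the
norm make sense) of finite norm. -/
def eUnifClass (φ η : ℝ → ℂ) (α : ℝ) : Set (ℝ → ℂ) :=
  {f | LocallyIntegrableOn f (Ioi 0) volume ∧ eUnifNorm φ η α f < (⊤ : ℝ≥0∞)}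

end Multiplier

end

/-! ### The inverse Fourier transform: scaling, inversion, products, derivatives. -/

namespace Multiplier

open FourierTransform SchwartzMap

/-! Put F = f_e. Both embeddings compare frequency pieces on the two sides of t = e^x, a change of
variable that is smooth with bounded derivatives on the relevant compact sets. A piece with spectrum
in [-R, R], R ≥ 1, and sup norm at most B, composed with log or exp and cut off, has N-th derivative
O(R^N B), by Bernstein's inequality (`exists_bernstein`) and the chain rule (`exists_comp_bound`).
Testing it at frequency λ therefore gains (R/λ)^N. Together with the trivial bound O(B),
`rpow_mul_le_of_pow_mul_le` gives O((R/λ)^s B) for every real 0 ≤ s ≤ N.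

For the first embedding, F is the sum of its dyadic pieces, with R = 2^|m|, and the localised
dilates are tested at λ = ⟨n⟩ (`exists_localized_bound`). Taking s = α+1+ε bounds the n-th piece of
every localised dilate by C⟨n⟩^{-s} times the Mihlin norm; against the weight ⟨n⟩^α there remains
the convergent sum of ⟨n⟩^{-1-ε}.

For the second, the localised dilates split into pieces p_{k,n} with R = ⟨n⟩, and F is rebuilt as
the sum over k, n of p_{k,n}(e^{x - k log 2}) χ(x - k log 2) with a cutoff χ. Each summand is tested
against the dyadic kernel at λ = 2^|m|, with s = α (`exists_sum_expPiece_conv_le`). The translates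
of χ overlap boundedly, so the sum over k costs a constant; the sum over n reproduces the given
norm; the loss ε pays for the sum over m.

The two decompositions are justified differently: `IsDyadicFourierPartition.hasSum_convCheck` uses
an approximate identity for bounded continuous F, while
`IsEquidistantPartition.ae_eq_tsum_convCheck` uses duality for integrable functions. -/

theorem exists_schwartz_check {u : ℝ → ℂ} (hu : ContDiff ℝ ∞ u) (hc : HasCompactSupport u) :
    ∃ κ : 𝓢(ℝ, ℂ), ⇑κ = check u := by
  have h2 : (2 * Real.pi)⁻¹ ≠ 0 := by positivity
  let g : ℝ ≃L[ℝ] ℝ := ContinuousLinearEquiv.unitsEquivAut ℝ (Units.mk0 _ h2)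
  refine ⟨(2 * (Real.pi : ℂ))⁻¹ •
    SchwartzMap.compCLMOfContinuousLinearEquiv ℂ g (𝓕⁻ (hc.toSchwartzMap hu)), ?_⟩
  ext x
  rw [check_eq_fourierInv]
  simp only [smul_apply, SchwartzMap.compCLMOfContinuousLinearEquiv_apply,
    Function.comp_apply, smul_eq_mul, SchwartzMap.fourierInv_coe]
  congr 2

theorem check_dilate (u : ℝ → ℂ) {r : ℝ} (hr : 0 < r) (x : ℝ) :
    check (fun t => u (r⁻¹ * t)) x = r * check u (r * x) := by
  unfold check
  have := Measure.integral_comp_mul_left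
    (fun ξ : ℝ => Complex.exp (Complex.I * ξ * (r * x : ℝ)) * u ξ) r⁻¹
  rw [inv_inv, abs_of_pos hr] at this
  rw [mul_left_comm, ← Complex.real_smul (x := r), ← this]
  congr 2
  ext ξ
  congr 2
  have : (r : ℂ) ≠ 0 := by exact_mod_cast hr.ne'
  push_cast
  field_simp

theorem check_translate (u : ℝ → ℂ) (a x : ℝ) :
    check (fun t => u (t - a)) x = Complex.exp (Complex.I * a * x) * check u x := by
  unfold check
  rw [mul_left_comm, ← integral_const_mul (Complex.exp _)]
  rw [← integral_sub_right_eq_self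
    (fun ξ : ℝ => Complex.exp (Complex.I * a * x) * (Complex.exp (Complex.I * ξ * x) * u ξ)) a]
  congr 2
  ext ξ
  rw [← mul_assoc, ← Complex.exp_add]
  congr 2
  push_cast
  ring

theorem check_sum {ι : Type*} (s : Finset ι) (u : ι → ℝ → ℂ) (hu : ∀ i ∈ s, Continuous (u i))
    (hc : ∀ i ∈ s, HasCompactSupport (u i)) (x : ℝ) :
    check (fun t => ∑ i ∈ s, u i t) x = ∑ i ∈ s, check (u i) x := by
  unfold check
  rw [← Finset.mul_sum, ← integral_finsetSum]
  · simp_rw [Finset.mul_sum]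
  · intro i hi
    exact Continuous.integrable_of_hasCompactSupport (by have := hu i hi; fun_prop)
      ((hc i hi).mul_left)

theorem integral_check_mul_exp {u : ℝ → ℂ} (hu : ContDiff ℝ ∞ u) (hc : HasCompactSupport u)
    (ξ : ℝ) : ∫ y, check u y * Complex.exp (-(Complex.I * ξ * y)) = u ξ := by
  have hπ : (0 : ℝ) < (2 * Real.pi)⁻¹ := by positivity
  have hinv : 𝓕 (𝓕⁻ u) ξ = u ξ := by
    have := congrArg (fun v : 𝓢(ℝ, ℂ) => v ξ) (FourierInvPair.fourier_fourierInv_eq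
      (F := 𝓢(ℝ, ℂ)) (hc.toSchwartzMap hu))
    rwa [SchwartzMap.fourier_coe, SchwartzMap.fourierInv_coe] at this
  rw [Real.fourier_real_eq_integral_exp_smul] at hinv
  rw [← hinv]
  have := Measure.integral_comp_mul_left
    (fun v : ℝ => Complex.exp (↑(-2 * Real.pi * v * ξ) * Complex.I) • 𝓕⁻ u v) (2 * Real.pi)⁻¹
  rw [inv_inv, abs_of_pos (by positivity), ← inv_smul_eq_iff₀ (by positivity), Complex.real_smul,
    ← integral_const_mul] at this
  rw [← this]
  congr 1
  ext y
  rw [check_eq_fourierInv]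
  have h : (Real.pi : ℂ) ≠ 0 := by exact_mod_cast Real.pi_ne_zero
  rw [smul_eq_mul, div_eq_inv_mul]
  have : (↑(-2 * Real.pi * ((2 * Real.pi)⁻¹ * y) * ξ) * Complex.I : ℂ)
      = -(Complex.I * ξ * y) := by
    push_cast
    field_simp
  rw [this]
  push_cast
  ring

theorem integral_check {u : ℝ → ℂ} (hu : ContDiff ℝ ∞ u) (hc : HasCompactSupport u) :
    ∫ y, check u y = u 0 := by
  simpa using integral_check_mul_exp hu hc 0

/-- Fubini and the splitting of e^{iξ(x-y)}: the inner integral over y is then Fourier inversion for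
u. -/
theorem integral_check_mul_check {u v : ℝ → ℂ} (hu : ContDiff ℝ ∞ u) (hcu : HasCompactSupport u)
    (hv : ContDiff ℝ ∞ v) (hcv : HasCompactSupport v) (x : ℝ) :
    ∫ y, check u y * check v (x - y) = check (fun ξ => u ξ * v ξ) x := by
  obtain ⟨κ, hκ⟩ := exists_schwartz_check hu hcu
  have hvi : Integrable v := hv.continuous.integrable_of_hasCompactSupport hcv
  have hprod : Integrable (Function.uncurry fun y ξ : ℝ =>
      check u y * (Complex.exp (Complex.I * ξ * ((x - y : ℝ) : ℂ)) * v ξ))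
      (volume.prod volume) := by
    have h := (κ.integrable (μ := volume)).mul_prod hvi
    rw [hκ] at h
    have h' := h.bdd_mul (f := fun p : ℝ × ℝ =>
      Complex.exp (Complex.I * p.2 * ((x - p.1 : ℝ) : ℂ))) (c := 1)
      (by fun_prop) (Filter.Eventually.of_forall fun p => by
        rw [Complex.norm_exp]; simp)
    refine h'.congr (Filter.Eventually.of_forall fun p => ?_)
    simp only [Function.uncurry]
    ring
  calc ∫ y, check u y * check v (x - y)
      = (2 * (Real.pi : ℂ))⁻¹ * ∫ y, ∫ ξ : ℝ,
          check u y * (Complex.exp (Complex.I * ξ * ((x - y : ℝ) : ℂ)) * v ξ) := by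
        rw [← integral_const_mul]
        congr 1
        ext y
        rw [integral_const_mul]
        unfold check
        ring
    _ = (2 * (Real.pi : ℂ))⁻¹ * ∫ ξ : ℝ, ∫ y,
          check u y * (Complex.exp (Complex.I * ξ * ((x - y : ℝ) : ℂ)) * v ξ) := by
        rw [integral_integral_swap hprod]
    _ = check (fun ξ => u ξ * v ξ) x := by
        conv_rhs => unfold check
        congr 2
        ext ξ
        change _ = Complex.exp (Complex.I * ξ * x) * (u ξ * v ξ)
        rw [← integral_check_mul_exp hu hcu ξ, ← integral_mul_const, ← integral_const_mul]
        congr 1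
        ext y
        have : Complex.exp (Complex.I * ξ * ((x - y : ℝ) : ℂ)) =
            Complex.exp (Complex.I * ξ * x) * Complex.exp (-(Complex.I * ξ * y)) := by
          rw [← Complex.exp_add]
          push_cast
          ring_nf
        rw [this]
        ring

theorem hasDerivAt_check {u : ℝ → ℂ} (hu : Continuous u) (hc : HasCompactSupport u) (x : ℝ) :
    HasDerivAt (check u) (check (fun ξ => Complex.I * ξ * u ξ) x) x := by
  have hi : Integrable u := hu.integrable_of_hasCompactSupport hc
  have hi' : Integrable (fun ξ : ℝ => ξ • u ξ) :=
    Continuous.integrable_of_hasCompactSupport (by fun_prop)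
      (HasCompactSupport.smul_left (f := fun ξ : ℝ => ξ) hc)
  have h := Real.hasDerivAt_fourier hi hi' (-(x / (2 * Real.pi)))
  have hlin : HasDerivAt (fun y : ℝ => -(y / (2 * Real.pi))) (-(1 / (2 * Real.pi))) x :=
    ((hasDerivAt_id x).div_const _).neg
  have h1 := (HasDerivAt.scomp_of_eq x h hlin rfl).const_mul (2 * (Real.pi : ℂ))⁻¹
  have hπ : (Real.pi : ℂ) ≠ 0 := by exact_mod_cast Real.pi_ne_zero
  have hfun : check u = fun y => (2 * (Real.pi : ℂ))⁻¹ *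
      (𝓕 u ∘ fun y : ℝ => -(y / (2 * Real.pi))) y := by
    ext y
    rw [check_eq_fourierInv, Real.fourierInv_eq_fourier_neg]
    rfl
  rw [hfun]
  refine h1.congr_deriv ?_
  rw [check_eq_fourierInv, Real.fourierInv_eq_fourier_neg, Complex.real_smul]
  congr 1
  rw [Real.fourier_real_eq, Real.fourier_real_eq, ← integral_const_mul]
  congr 1
  ext v
  simp only [Circle.smul_def, smul_eq_mul]
  push_cast
  field_simp

theorem iteratedDeriv_check {u : ℝ → ℂ} (hu : Continuous u) (hc : HasCompactSupport u) (N : ℕ) :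
    iteratedDeriv N (check u) = check (fun ξ => (Complex.I * ξ) ^ N * u ξ) := by
  induction N generalizing u with
  | zero => simp
  | succ N ih =>
    have : deriv (check u) = check (fun ξ => Complex.I * ξ * u ξ) :=
      funext fun x => (hasDerivAt_check hu hc x).deriv
    rw [iteratedDeriv_succ', this, ih (u := fun ξ : ℝ => Complex.I * ξ * u ξ) (by fun_prop) hc.mul_left]
    congr 1
    ext ξ
    ring

end Multiplier

/-! ### Convolution with band-limited kernels and Bernstein's inequality. -/

namespace Multiplier

open SchwartzMap

theorem convCheck_apply (h u : ℝ → ℂ) (x : ℝ) :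
    convCheck h u x = ∫ t, h t * check u (x - t) := rfl

theorem exists_schwartz_iteratedDeriv (κ : 𝓢(ℝ, ℂ)) (N : ℕ) :
    ∃ κ' : 𝓢(ℝ, ℂ), ⇑κ' = iteratedDeriv N κ := by
  induction N with
  | zero => exact ⟨κ, by simp⟩
  | succ N ih =>
    obtain ⟨κ', h⟩ := ih
    refine ⟨SchwartzMap.derivCLM ℝ ℂ κ', ?_⟩
    ext x
    rw [SchwartzMap.derivCLM_apply, h, iteratedDeriv_succ]

theorem integrable_one_add_abs_sub_inv_sq (x : ℝ) :
    Integrable (fun t : ℝ => ((1 + |x - t|) ^ 2)⁻¹) := by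
  have h := integrable_one_add_norm (E := ℝ) (μ := volume) (r := 2) (by simp)
  have h' := (h.comp_sub_left x)
  refine h'.congr (Filter.Eventually.of_forall fun t => ?_)
  simp only [Real.norm_eq_abs]
  rw [Real.rpow_neg (by positivity)]
  norm_cast

theorem exists_schwartz_decay (κ : 𝓢(ℝ, ℂ)) :
    ∃ C : ℝ, 0 ≤ C ∧ ∀ x, ‖κ x‖ ≤ C * ((1 + |x|) ^ 2)⁻¹ := by
  obtain ⟨C₀, h0⟩ := κ.decay 0 0
  obtain ⟨C₂, h2⟩ := κ.decay 2 0
  refine ⟨2 * (C₀ + C₂), by linarith [h0.1, h2.1], fun x => ?_⟩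
  have h0 := h0.2 x
  have h2 := h2.2 x
  simp only [pow_zero, one_mul, norm_iteratedFDeriv_zero, Real.norm_eq_abs] at h0 h2
  rw [← div_eq_mul_inv, le_div_iff₀ (by positivity)]
  -- This is (1 + |x|)² ≤ 2(1 + |x|²), whence the factor 2.
  nlinarith [mul_nonneg (norm_nonneg (κ x)) (sq_nonneg (1 - |x|))]

theorem integrable_bounded_mul_schwartz {G : ℝ → ℂ} {B : ℝ} (hG : Continuous G)
    (hB : ∀ x, ‖G x‖ ≤ B) (κ : 𝓢(ℝ, ℂ)) (x : ℝ) : Integrable (fun t => G t * κ (x - t)) :=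
  ((κ.integrable (μ := volume)).comp_sub_left x).bdd_mul (c := B) hG.aestronglyMeasurable
    (Filter.Eventually.of_forall hB)

theorem hasDerivAt_conv_schwartz {G : ℝ → ℂ} {B : ℝ} (hG : Continuous G)
    (hB : ∀ x, ‖G x‖ ≤ B) (κ : 𝓢(ℝ, ℂ)) (x : ℝ) :
    HasDerivAt (fun x => ∫ t, G t * κ (x - t)) (∫ t, G t * deriv κ (x - t)) x := by
  obtain ⟨C, hC, hdec⟩ := exists_schwartz_decay (SchwartzMap.derivCLM ℝ ℂ κ)
  have hB0 : 0 ≤ B := (norm_nonneg _).trans (hB 0)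
  refine (hasDerivAt_integral_of_dominated_loc_of_deriv_le (Metric.ball_mem_nhds x one_pos)
    (F := fun x t => G t * κ (x - t)) (F' := fun x t => G t * deriv κ (x - t))
    -- The 4 makes one majorant serve all y in the unit ball around x, where 1 + |x - t| ≤ 2(1 + |y
    -- - t|).
    (bound := fun t => B * (C * (4 * ((1 + |x - t|) ^ 2)⁻¹)))
    (Filter.Eventually.of_forall fun y =>
      (integrable_bounded_mul_schwartz hG hB κ y).aestronglyMeasurable)
    (integrable_bounded_mul_schwartz hG hB κ x) ?_
    (Filter.Eventually.of_forall fun t y hy => ?_)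
    ((((integrable_one_add_abs_sub_inv_sq x).const_mul 4).const_mul C).const_mul B)
    (Filter.Eventually.of_forall fun t y _ => ?_)).2
  · exact (integrable_bounded_mul_schwartz hG hB
      (SchwartzMap.derivCLM ℝ ℂ κ) x).aestronglyMeasurable
  · rw [norm_mul]
    have h1 := hdec (y - t)
    rw [SchwartzMap.derivCLM_apply] at h1
    refine mul_le_mul (hB t) (h1.trans ?_) (norm_nonneg _) hB0
    refine mul_le_mul_of_nonneg_left ?_ hC
    rw [← div_eq_mul_inv, inv_eq_one_div, div_le_div_iff₀ (by positivity) (by positivity)]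
    rw [Metric.mem_ball, Real.dist_eq] at hy
    have h2 : |x - t| ≤ |y - t| + 1 := by
      have h3 := abs_sub_le x y t
      rw [abs_sub_comm] at hy
      linarith
    have h4 : 1 + |x - t| ≤ 2 * (1 + |y - t|) := by linarith [abs_nonneg (y - t)]
    have h5 := pow_le_pow_left₀ (by positivity) h4 2
    nlinarith
  · exact ((κ.hasDerivAt (y - t)).comp_sub_const y t).const_mul (G t)

theorem iteratedDeriv_conv_schwartz {G : ℝ → ℂ} {B : ℝ} (hG : Continuous G)
    (hB : ∀ x, ‖G x‖ ≤ B) (κ : 𝓢(ℝ, ℂ)) (N : ℕ) :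
    iteratedDeriv N (fun x => ∫ t, G t * κ (x - t)) =
      fun x => ∫ t, G t * iteratedDeriv N κ (x - t) := by
  induction N with
  | zero => simp
  | succ N ih =>
    obtain ⟨κ', h⟩ := exists_schwartz_iteratedDeriv κ N
    rw [iteratedDeriv_succ, ih, ← h]
    ext x
    rw [(hasDerivAt_conv_schwartz hG hB κ' x).deriv, iteratedDeriv_succ, h]

theorem contDiff_conv_schwartz {G : ℝ → ℂ} {B : ℝ} (hG : Continuous G)
    (hB : ∀ x, ‖G x‖ ≤ B) (κ : 𝓢(ℝ, ℂ)) : ContDiff ℝ ∞ (fun x => ∫ t, G t * κ (x - t)) := by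
  refine contDiff_of_differentiable_iteratedDeriv fun N _ x => ?_
  obtain ⟨κ', h⟩ := exists_schwartz_iteratedDeriv κ N
  rw [iteratedDeriv_conv_schwartz hG hB, ← h]
  exact (hasDerivAt_conv_schwartz hG hB κ' x).differentiableAt

theorem norm_conv_le {G κ : ℝ → ℂ} {B : ℝ} (hB : ∀ x, ‖G x‖ ≤ B) (hκ : Integrable κ) (x : ℝ) :
    ‖∫ t, G t * κ (x - t)‖ ≤ B * ∫ t, ‖κ t‖ := by
  rw [← integral_sub_left_eq_self (fun t => ‖κ t‖) volume x, ← integral_const_mul]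
  refine norm_integral_le_of_norm_le ((hκ.comp_sub_left x).norm.const_mul B)
    (Filter.Eventually.of_forall fun t => ?_)
  rw [norm_mul]
  exact mul_le_mul_of_nonneg_right (hB t) (norm_nonneg _)

/-- The functions `h` for which the convolutions `h ∗ ǔ`, `u ∈ C_c^∞`, are used below. -/
def Convolvable (h : ℝ → ℂ) : Prop :=
  Integrable h ∨ (Continuous h ∧ ∃ K : ℝ, ∀ x, ‖h x‖ ≤ K)

theorem exists_norm_schwartz_le (κ : 𝓢(ℝ, ℂ)) : ∃ C : ℝ, ∀ x, ‖κ x‖ ≤ C := by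
  obtain ⟨C, -, h⟩ := κ.decay 0 0
  exact ⟨C, fun x => by simpa using h x⟩

theorem continuous_convCheck {h u : ℝ → ℂ} (hh : Convolvable h) (hu : ContDiff ℝ ∞ u)
    (hc : HasCompactSupport u) : Continuous (convCheck h u) := by
  obtain ⟨κ, hκ⟩ := exists_schwartz_check hu hc
  rcases hh with hi | ⟨hcont, K, hK⟩
  · obtain ⟨C, hC⟩ := exists_norm_schwartz_le κ
    refine BddAbove.continuous_convolution_right_of_integrable _ ⟨C, ?_⟩ hi (hκ ▸ κ.continuous)
    rintro _ ⟨x, rfl⟩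
    exact hκ ▸ hC x
  · exact (hκ ▸ contDiff_conv_schwartz hcont hK κ :
      ContDiff ℝ ∞ (fun x => ∫ t, h t * check u (x - t))).continuous

/-- Associativity of convolution by Fubini. If h is integrable, one kernel is merely bounded; if h
is only bounded, joint integrability comes from the two kernels instead. -/
theorem convCheck_conv_check {h u v : ℝ → ℂ} (hh : Convolvable h)
    (hu : ContDiff ℝ ∞ u) (hcu : HasCompactSupport u)
    (hv : ContDiff ℝ ∞ v) (hcv : HasCompactSupport v) (x : ℝ) :
    ∫ y, convCheck h u y * check v (x - y) = convCheck h (fun ξ => u ξ * v ξ) x := by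
  obtain ⟨κ, hκ⟩ := exists_schwartz_check hu hcu
  obtain ⟨μ, hμ⟩ := exists_schwartz_check hv hcv
  have hint : Integrable (Function.uncurry fun y t : ℝ =>
      h t * check u (y - t) * check v (x - y)) (volume.prod volume) := by
    rw [← hκ, ← hμ]
    rcases hh with hi | ⟨hcont, K, hK⟩
    · obtain ⟨C, hC⟩ := exists_norm_schwartz_le μ
      have h1 := hi.convolution_integrand (ContinuousLinearMap.mul ℂ ℂ)
        (κ.integrable (μ := volume))
      exact h1.mul_bdd (c := C)
        ((μ.continuous.comp (by fun_prop : Continuous fun p : ℝ × ℝ => x - p.1)).aestronglyMeasurable)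
        (Filter.Eventually.of_forall fun p => hC _)
    · have h1 := ((μ.integrable (μ := volume)).comp_sub_left x).convolution_integrand
        (ContinuousLinearMap.mul ℂ ℂ) ((κ.integrable (μ := volume)).comp_neg)
      have h2 := (h1.bdd_mul (f := fun p : ℝ × ℝ => h p.1) (c := K)
        ((hcont.comp continuous_fst).aestronglyMeasurable)
        (Filter.Eventually.of_forall fun p => hK _)).swap
      refine h2.congr (Filter.Eventually.of_forall fun p => ?_)
      simp only [Function.comp_apply, Prod.swap, Function.uncurry,
        ContinuousLinearMap.mul_apply', neg_sub]
      ring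
  calc ∫ y, convCheck h u y * check v (x - y)
      = ∫ y, ∫ t, h t * check u (y - t) * check v (x - y) := by
        congr 1
        ext y
        rw [convCheck_apply, integral_mul_const]
    _ = ∫ t, ∫ y, h t * check u (y - t) * check v (x - y) := integral_integral_swap hint
    _ = convCheck h (fun ξ => u ξ * v ξ) x := by
        rw [convCheck_apply]
        congr 1
        ext t
        rw [← integral_check_mul_check hu hcu hv hcv, ← integral_const_mul,
          ← integral_add_right_eq_self _ t]
        congr 1
        ext y
        rw [add_sub_cancel_right, sub_sub, add_comm t y, mul_assoc]

/-- A smooth cutoff, equal to `1` on `[-1, 1]` and supported in `[-2, 2]`. -/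
noncomputable def cutoff : ContDiffBump (0 : ℝ) := ⟨1, 2, one_pos, one_lt_two⟩

theorem contDiff_cutoff : ContDiff ℝ ∞ (fun t => (cutoff t : ℂ)) :=
  Complex.ofRealCLM.contDiff.comp cutoff.contDiff

theorem hasCompactSupport_cutoff : HasCompactSupport (fun t => (cutoff t : ℂ)) :=
  cutoff.hasCompactSupport.comp_left (g := fun x : ℝ => (x : ℂ)) Complex.ofReal_zero

theorem cutoff_eq_one {t : ℝ} (ht : |t| ≤ 1) : cutoff t = 1 :=
  cutoff.one_of_mem_closedBall (by simpa [cutoff] using ht)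

theorem cutoff_eq_zero {t : ℝ} (ht : 2 ≤ |t|) : cutoff t = 0 :=
  cutoff.zero_of_le_dist (by simpa [cutoff] using ht)

/-- The cutoff rescaled by R is 1 on the support of u, so the band-limited function reproduces
itself under convolution with the rescaled cutoff kernel. After normalising to R = 1 all derivatives
fall on one fixed kernel, whose L¹ norms are the universal constants `b`. -/
theorem exists_bernstein : ∃ b : ℕ → ℝ, (∀ j, 0 ≤ b j) ∧ ∀ (h u : ℝ → ℂ) (R B : ℝ), 0 < R →
    Convolvable h → ContDiff ℝ ∞ u → tsupport u ⊆ Icc (-R) R → (∀ x, ‖convCheck h u x‖ ≤ B) →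
    ∃ G : ℝ → ℂ, ContDiff ℝ ∞ G ∧ (∀ x, convCheck h u x = G (R * x)) ∧
      ∀ j y, ‖iteratedDeriv j G y‖ ≤ b j * B := by
  obtain ⟨κ, hκ⟩ := exists_schwartz_check contDiff_cutoff hasCompactSupport_cutoff
  refine ⟨fun j => ∫ t, ‖iteratedDeriv j κ t‖, fun j => integral_nonneg fun t => norm_nonneg _,
    fun h u R B hR hh hu hs hB => ?_⟩
  have hcu : HasCompactSupport u := HasCompactSupport.of_support_subset_isCompact isCompact_Icc
    ((subset_tsupport u).trans hs)
  have hcont := continuous_convCheck hh hu hcu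
  have hrep : ∀ y, convCheck h u (R⁻¹ * y) =
      ∫ t, convCheck h u (R⁻¹ * t) * κ (y - t) := by
    intro y
    have hv : ContDiff ℝ ∞ (fun t => (cutoff (R⁻¹ * t) : ℂ)) :=
      contDiff_cutoff.comp (contDiff_const.mul contDiff_id)
    have hcv : HasCompactSupport (fun t => (cutoff (R⁻¹ * t) : ℂ)) :=
      hasCompactSupport_cutoff.comp_homeomorph (Homeomorph.mulLeft₀ R⁻¹ (inv_ne_zero hR.ne'))
    have h1 := convCheck_conv_check hh hu hcu hv hcv (R⁻¹ * y)
    have h2 : (fun ξ => u ξ * (cutoff (R⁻¹ * ξ) : ℂ)) = u := by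
      ext ξ
      by_cases hξ : ξ ∈ tsupport u
      · have := hs hξ
        rw [cutoff_eq_one, Complex.ofReal_one, mul_one]
        rw [abs_mul, abs_of_pos (inv_pos.2 hR), inv_mul_le_iff₀ hR, mul_one]
        exact abs_le.2 this
      · rw [image_eq_zero_of_notMem_tsupport hξ, zero_mul]
    rw [h2] at h1
    rw [← h1]
    have h3 := Measure.integral_comp_mul_left
      (fun t => convCheck h u t * (R * check (fun t => (cutoff t : ℂ)) (R * (R⁻¹ * y - t)))) R⁻¹
    rw [inv_inv, abs_of_pos hR, Complex.real_smul] at h3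
    simp_rw [check_dilate (fun t => (cutoff t : ℂ)) hR]
    rw [← mul_right_inj' (by exact_mod_cast hR.ne' : (R : ℂ) ≠ 0), ← h3, ← integral_const_mul]
    congr 1
    ext t
    rw [hκ, ← mul_sub, mul_inv_cancel_left₀ hR.ne']
    ring
  have hfun : (fun y => convCheck h u (R⁻¹ * y)) =
      fun y => ∫ t, convCheck h u (R⁻¹ * t) * κ (y - t) := funext hrep
  have hcont' : Continuous (fun y => convCheck h u (R⁻¹ * y)) := by fun_prop
  refine ⟨fun y => convCheck h u (R⁻¹ * y), ?_, fun x => ?_, fun j y => ?_⟩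
  · rw [hfun]
    exact contDiff_conv_schwartz hcont' (fun y => hB _) κ
  · simp only [inv_mul_cancel_left₀ hR.ne']
  · obtain ⟨κ', h'⟩ := exists_schwartz_iteratedDeriv κ j
    rw [hfun, iteratedDeriv_conv_schwartz hcont' (fun y => hB _), ← h', mul_comm]
    simp only [← h']
    exact norm_conv_le (fun y => hB _) κ'.integrable y

end Multiplier

/-! ### Derivative bounds under composition, and oscillatory integrals. -/

namespace Multiplier

open SchwartzMap FourierTransform

theorem norm_iteratedDeriv_mul_le_of_bound {f g : ℝ → ℂ} (hf : ContDiff ℝ ∞ f)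
    (hg : ContDiff ℝ ∞ g) {N : ℕ} {a b t : ℝ} (ha : ∀ i ≤ N, ‖iteratedDeriv i f t‖ ≤ a)
    (hb : ∀ i ≤ N, ‖iteratedDeriv i g t‖ ≤ b) {i : ℕ} (hi : i ≤ N) :
    ‖iteratedDeriv i (fun t => f t * g t) t‖ ≤ 2 ^ N * (a * b) := by
  have ha0 : 0 ≤ a := (norm_nonneg _).trans (ha 0 (Nat.zero_le _))
  have hb0 : 0 ≤ b := (norm_nonneg _).trans (hb 0 (Nat.zero_le _))
  have h := norm_iteratedFDeriv_mul_le hf hg t (n := i) (by exact_mod_cast le_top)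
  simp only [norm_iteratedFDeriv_eq_norm_iteratedDeriv] at h
  refine h.trans ?_
  calc ∑ j ∈ Finset.range (i + 1), (i.choose j : ℝ) * ‖iteratedDeriv j f t‖ *
        ‖iteratedDeriv (i - j) g t‖
      ≤ ∑ j ∈ Finset.range (i + 1), (i.choose j : ℝ) * (a * b) := by
        refine Finset.sum_le_sum fun j hj => ?_
        rw [mul_assoc]
        have hj' : j ≤ N := (Nat.lt_succ_iff.1 (Finset.mem_range.1 hj)).trans hi
        exact mul_le_mul_of_nonneg_left (mul_le_mul (ha j hj') (hb _ ((Nat.sub_le _ _).trans hi))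
          (norm_nonneg _) ha0) (Nat.cast_nonneg _)
    _ = 2 ^ i * (a * b) := by
        rw [← Finset.sum_mul]
        congr 1
        exact_mod_cast Nat.sum_range_choose i
    _ ≤ 2 ^ N * (a * b) :=
        mul_le_mul_of_nonneg_right (pow_le_pow_right₀ one_le_two hi) (mul_nonneg ha0 hb0)

theorem exists_iteratedDeriv_bound_on_compact {ℓ : ℝ → ℝ} (hℓ : ContDiff ℝ ∞ ℓ) {K : Set ℝ}
    (hK : IsCompact K) (N : ℕ) :
    ∃ d : ℝ, 1 ≤ d ∧ ∀ i ≤ N, ∀ t ∈ K, ‖iteratedDeriv i ℓ t‖ ≤ d := by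
  have h : ∀ i, ∃ d : ℝ, ∀ t ∈ K, ‖iteratedDeriv i ℓ t‖ ≤ d := fun i =>
    hK.exists_bound_of_continuousOn (hℓ.continuous_iteratedDeriv i
      (by exact_mod_cast le_top)).continuousOn
  choose d hd using h
  refine ⟨1 + ∑ i ∈ Finset.range (N + 1), |d i|,
    le_add_of_nonneg_right (Finset.sum_nonneg fun _ _ => abs_nonneg _), fun i hi t ht => ?_⟩
  refine (hd i t ht).trans ((le_abs_self _).trans ?_)
  have := Finset.single_le_sum (f := fun i => |d i|) (fun _ _ => abs_nonneg _)
    (Finset.mem_range.2 (Nat.lt_succ_of_le hi))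
  linarith

/-- Faà di Bruno: at most N factors of R come out. Having `R` and `d` at least 1 lets R d ≤ (R d)^j
bound the j-th derivative of the inner function and lets every order i ≤ N share the power N. The
shift `c` does not enter the constant, which makes later bounds uniform in k. -/
theorem exists_comp_bound {ℓ : ℝ → ℝ} (hℓ : ContDiff ℝ ∞ ℓ) {K : Set ℝ} (hK : IsCompact K)
    (N : ℕ) : ∃ C : ℝ, 0 ≤ C ∧ ∀ (G : ℝ → ℂ) (R c B : ℝ), 1 ≤ R → ContDiff ℝ ∞ G →
      (∀ i ≤ N, ∀ y, ‖iteratedDeriv i G y‖ ≤ B) → ∀ i ≤ N, ∀ t ∈ K,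
        ‖iteratedDeriv i (fun t => G (R * ℓ t + c)) t‖ ≤ C * R ^ N * B := by
  obtain ⟨d, hd1, hd⟩ := exists_iteratedDeriv_bound_on_compact hℓ hK N
  refine ⟨N.factorial * d ^ N, by positivity, fun G R c B hR hG hB i hi t ht => ?_⟩
  have hB0 : 0 ≤ B := (norm_nonneg _).trans (hB 0 (Nat.zero_le _) 0)
  have hRd : 1 ≤ R * d := one_le_mul_of_one_le_of_one_le hR hd1
  have h := norm_iteratedFDeriv_comp_le (n := i) hG
    (f := fun t => R * ℓ t + c) (by fun_prop) (by exact_mod_cast le_top) t (C := B) (D := R * d)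
    (fun j hj => by
      rw [norm_iteratedFDeriv_eq_norm_iteratedDeriv]
      exact hB j (hj.trans hi) _)
    (fun j h1 hj => by
      rw [norm_iteratedFDeriv_eq_norm_iteratedDeriv]
      have : (fun t => R * ℓ t + c) = fun t => c + R * ℓ t := by ext; ring
      rw [this, iteratedDeriv_const_add h1, iteratedDeriv_const_mul_field, norm_mul,
        Real.norm_of_nonneg (by linarith)]
      refine le_trans ?_ (le_self_pow₀ hRd (by omega))
      exact mul_le_mul_of_nonneg_left (hd j (hj.trans hi) t ht) (by linarith))
  rw [norm_iteratedFDeriv_eq_norm_iteratedDeriv] at h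
  refine h.trans ?_
  have h1 : (i.factorial : ℝ) ≤ N.factorial := by exact_mod_cast Nat.factorial_le hi
  have h2 : (R * d) ^ i ≤ (R * d) ^ N := pow_le_pow_right₀ hRd hi
  calc (i.factorial : ℝ) * B * (R * d) ^ i ≤ N.factorial * B * (R * d) ^ N := by
        gcongr
    _ = N.factorial * d ^ N * R ^ N * B := by rw [mul_pow]; ring

theorem iteratedDeriv_eq_zero_of_notMem_tsupport {f : ℝ → ℂ} {t : ℝ} (ht : t ∉ tsupport f)
    (i : ℕ) : iteratedDeriv i f t = 0 := by
  rw [← norm_eq_zero, ← norm_iteratedFDeriv_eq_norm_iteratedDeriv, norm_eq_zero]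
  exact Function.notMem_support.1 fun h => ht (support_iteratedFDeriv_subset i h)

/-- Leibniz on `K`; off `K` the product and all its derivatives vanish, so a bound on the compact
set becomes global. -/
theorem exists_comp_mul_bound {ℓ : ℝ → ℝ} (hℓ : ContDiff ℝ ∞ ℓ) {K : Set ℝ} (hK : IsCompact K)
    (N : ℕ) : ∃ C : ℝ, 0 ≤ C ∧ ∀ (G θ : ℝ → ℂ) (R c B M : ℝ), 1 ≤ R → ContDiff ℝ ∞ G →
      (∀ i ≤ N, ∀ y, ‖iteratedDeriv i G y‖ ≤ B) → ContDiff ℝ ∞ θ → tsupport θ ⊆ K →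
      (∀ i ≤ N, ∀ t, ‖iteratedDeriv i θ t‖ ≤ M) → ∀ i ≤ N, ∀ t,
        ‖iteratedDeriv i (fun t => G (R * ℓ t + c) * θ t) t‖ ≤ C * R ^ N * B * M := by
  obtain ⟨C, hC0, hC⟩ := exists_comp_bound hℓ hK N
  refine ⟨2 ^ N * C, by positivity, fun G θ R c B M hR hG hB hθ hs hM i hi t => ?_⟩
  have hB0 : 0 ≤ B := (norm_nonneg _).trans (hB 0 (Nat.zero_le _) 0)
  have hM0 : 0 ≤ M := (norm_nonneg _).trans (hM 0 (Nat.zero_le _) 0)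
  by_cases ht : t ∈ K
  · have := norm_iteratedDeriv_mul_le_of_bound (f := fun t => G (R * ℓ t + c)) (by fun_prop) hθ
      (fun j hj => hC G R c B hR hG hB j hj t ht) (fun j hj => hM j hj t) hi
    exact this.trans_eq (by ring)
  · rw [iteratedDeriv_eq_zero_of_notMem_tsupport, norm_zero]
    · have : 0 ≤ R := by linarith
      positivity
    · exact fun h => ht (hs (tsupport_mul_subset_right h))

theorem exists_schwartz_iteratedDeriv_bound (κ : 𝓢(ℝ, ℂ)) (N : ℕ) :
    ∃ C : ℝ, 0 ≤ C ∧ ∀ i ≤ N, ∀ t, ‖iteratedDeriv i κ t‖ ≤ C := by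
  refine ⟨∑ i ∈ Finset.range (N + 1), SchwartzMap.seminorm ℝ 0 i κ,
    Finset.sum_nonneg fun _ _ => apply_nonneg _ _, fun i hi t => ?_⟩
  have h := κ.le_seminorm' ℝ 0 i t
  rw [pow_zero, one_mul] at h
  exact h.trans (Finset.single_le_sum (f := fun i => SchwartzMap.seminorm ℝ 0 i κ)
    (fun _ _ => apply_nonneg _ _) (Finset.mem_range.2 (Nat.lt_succ_of_le hi)))

theorem exists_iteratedDeriv_bound {u : ℝ → ℂ} (hu : ContDiff ℝ ∞ u) (hc : HasCompactSupport u)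
    (N : ℕ) : ∃ C : ℝ, 0 ≤ C ∧ ∀ i ≤ N, ∀ t, ‖iteratedDeriv i u t‖ ≤ C :=
  exists_schwartz_iteratedDeriv_bound (hc.toSchwartzMap hu) N

/-- The oscillatory integral `∫ w(t) e^{-iξt} dt` decays like `|ξ|⁻ᴺ`. -/
theorem pow_mul_norm_integral_mul_exp_le {w : ℝ → ℂ} (hw : ContDiff ℝ ∞ w)
    (hc : HasCompactSupport w) (N : ℕ) (ξ : ℝ) :
    |ξ| ^ N * ‖∫ t, w t * Complex.exp (-(Complex.I * ξ * t))‖ ≤ ∫ t, ‖iteratedDeriv N w t‖ := by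
  have h := Real.fourier_iteratedDeriv (N := ⊤) hw (fun n _ => by
    obtain ⟨κ, hκ⟩ := exists_schwartz_iteratedDeriv (hc.toSchwartzMap hw) n
    have := κ.integrable (μ := volume)
    rwa [hκ] at this) (n := N) le_top
  have h1 := congrFun h (ξ / (2 * Real.pi))
  have hπ : (Real.pi : ℂ) ≠ 0 := by exact_mod_cast Real.pi_ne_zero
  have h2 : 𝓕 w (ξ / (2 * Real.pi)) = ∫ t, w t * Complex.exp (-(Complex.I * ξ * t)) := by
    rw [Real.fourier_real_eq_integral_exp_smul]
    congr 1
    ext t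
    rw [smul_eq_mul, mul_comm]
    congr 2
    push_cast
    field_simp
  have h3 : ‖(2 * Real.pi * Complex.I * ((ξ / (2 * Real.pi) : ℝ) : ℂ)) ^ N‖ = |ξ| ^ N := by
    rw [norm_pow]
    congr 1
    have : 2 * Real.pi * Complex.I * ((ξ / (2 * Real.pi) : ℝ) : ℂ) = Complex.I * ξ := by
      push_cast
      field_simp
    rw [this]
    simp
  rw [h2, smul_eq_mul] at h1
  rw [← h3, ← norm_mul, ← h1, Real.fourier_real_eq_integral_exp_smul]
  refine (norm_integral_le_integral_norm _).trans_eq ?_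
  congr 1
  ext t
  rw [norm_smul, Complex.norm_exp_ofReal_mul_I, one_mul]

/-- A smooth function on `ℝ` that agrees with `log` on `[1/2, 2]`. -/
theorem exists_smooth_log : ∃ ℓ : ℝ → ℝ, ContDiff ℝ ∞ ℓ ∧ ∀ t ∈ Icc (1 / 2 : ℝ) 2,
    ℓ t = Real.log t := by
  let b : ContDiffBump (5 / 4 : ℝ) := ⟨3 / 4, 1, by norm_num, by norm_num⟩
  refine ⟨fun t => b t * Real.log t, ?_, fun t ht => ?_⟩
  · rw [contDiff_iff_contDiffAt]
    intro t
    rcases lt_or_ge t (1 / 4) with h | h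
    · have : (fun t => b t * Real.log t) =ᶠ[nhds t] fun _ => 0 := by
        filter_upwards [Iio_mem_nhds h] with s hs
        have : b s = 0 := b.zero_of_le_dist (by
          rw [Real.dist_eq, abs_sub_comm]
          refine le_trans ?_ (le_abs_self _)
          simp only [b]
          linarith [mem_Iio.1 hs])
        simp [this]
      exact contDiffAt_const.congr_of_eventuallyEq this
    · exact b.contDiffAt.mul (Real.contDiffAt_log.2 (by linarith))
  · have : b t = 1 := b.one_of_mem_closedBall (by
      rw [Metric.mem_closedBall, Real.dist_eq, abs_le]
      simp only [b]
      constructor <;> linarith [ht.1, ht.2])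
    simp [this]

theorem norm_integral_le_of_tsupport {w : ℝ → ℂ} {a b C : ℝ} (hab : a ≤ b)
    (hs : ∀ t ∉ Icc a b, w t = 0) (hC : ∀ t, ‖w t‖ ≤ C) : ∫ t, ‖w t‖ ≤ C * (b - a) := by
  have h1 : ∫ t, ‖w t‖ = ∫ t in Icc a b, ‖w t‖ := by
    rw [setIntegral_eq_integral_of_forall_compl_eq_zero]
    intro t ht
    rw [hs t ht, norm_zero]
  rw [h1]
  have h2 := norm_setIntegral_le_of_norm_le_const (μ := volume) (s := Icc a b)
    (f := fun t => ‖w t‖) (C := C) (by simp) (fun t _ => by rw [norm_norm]; exact hC t)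
  rw [Measure.real, Real.volume_Icc, ENNReal.toReal_ofReal (by linarith)] at h2
  exact (le_abs_self _).trans h2

/-- The decay of the frequency pieces of `H(log t + c) η(t)` for a function `H = h ∗ ǔ` with
spectrum in `[-R, R]`. -/
theorem exists_localized_bound {φ η : ℝ → ℂ} (hφ : IsEquidistantPartition φ)
    (hη : IsDyadicPartition η) (N : ℕ) : ∃ C : ℝ, 0 ≤ C ∧ ∀ (h u : ℝ → ℂ) (R B c : ℝ), 1 ≤ R →
      Convolvable h → ContDiff ℝ ∞ u → tsupport u ⊆ Icc (-R) R → (∀ x, ‖convCheck h u x‖ ≤ B) →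
      ∀ (n : ℤ) (x : ℝ), (1 + |(n : ℝ)|) ^ N *
        ‖∫ t, convCheck h u (Real.log t + c) * η t * check (fun t => φ (t - n)) (x - t)‖ ≤
          C * R ^ N * B := by
  obtain ⟨b, hb0, hb⟩ := exists_bernstein
  obtain ⟨ℓ, hℓ, hlog⟩ := exists_smooth_log
  have hcφ : HasCompactSupport φ := HasCompactSupport.of_support_subset_isCompact isCompact_Icc
    ((subset_tsupport _).trans hφ.support)
  have hcη : HasCompactSupport η := HasCompactSupport.of_support_subset_isCompact isCompact_Icc
    ((subset_tsupport _).trans hη.support)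
  obtain ⟨κ, hκ⟩ := exists_schwartz_check hφ.smooth hcφ
  obtain ⟨C₁, hC₁0, hC₁⟩ := exists_comp_mul_bound hℓ (isCompact_Icc (a := (1 / 2 : ℝ)) (b := 2)) N
  obtain ⟨C₂, hC₂0, hC₂⟩ := exists_iteratedDeriv_bound hη.smooth hcη N
  obtain ⟨C₃, hC₃0, hC₃⟩ := exists_schwartz_iteratedDeriv_bound κ N
  set S := ∑ i ∈ Finset.range (N + 1), b i with hS
  have hS0 : 0 ≤ S := Finset.sum_nonneg fun i _ => hb0 i
  set D := C₁ * S * (2 ^ N * (C₂ * C₃)) with hD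
  have hD0 : 0 ≤ D := by positivity
  refine ⟨2 ^ N * (3 * D), by positivity, fun h u R B c hR hh hu hs hB n x => ?_⟩
  have hB0 : 0 ≤ B := (norm_nonneg _).trans (hB 0)
  obtain ⟨G, hG, hGeq, hGb⟩ := hb h u R B (by linarith) hh hu hs hB
  have hGb' : ∀ i ≤ N, ∀ y, ‖iteratedDeriv i G y‖ ≤ S * B := fun i hi y =>
    (hGb i y).trans (mul_le_mul_of_nonneg_right (Finset.single_le_sum (f := b)
      (fun i _ => hb0 i) (Finset.mem_range.2 (Nat.lt_succ_of_le hi))) hB0)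
  -- The unmodulated kernel is absorbed into the amplitude; its derivative bounds do not depend on
  -- `x`.
  let θ : ℝ → ℂ := fun t => η t * κ (x - t)
  have hκs : ContDiff ℝ ∞ (fun t => κ (x - t)) := (κ.smooth _).comp (by fun_prop)
  have hθ : ContDiff ℝ ∞ θ := hη.smooth.mul hκs
  have hθs : tsupport θ ⊆ Icc (1 / 2) 2 := (tsupport_mul_subset_left (f := η)).trans hη.support
  have hθb : ∀ i ≤ N, ∀ t, ‖iteratedDeriv i θ t‖ ≤ 2 ^ N * (C₂ * C₃) := fun i hi t =>
    norm_iteratedDeriv_mul_le_of_bound hη.smooth hκs (fun j hj => hC₂ j hj t) (fun j hj => by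
      rw [iteratedDeriv_comp_const_sub, norm_smul, norm_pow, norm_neg, norm_one, one_pow, one_mul]
      exact hC₃ j hj _) hi
  let w : ℝ → ℂ := fun t => G (R * ℓ t + R * c) * θ t
  have hw : ContDiff ℝ ∞ w := by
    have : ContDiff ℝ ∞ fun t => G (R * ℓ t + R * c) := by fun_prop
    exact this.mul hθ
  have hws : tsupport w ⊆ Icc (1 / 2) 2 := tsupport_mul_subset_right.trans hθs
  have hcw : HasCompactSupport w := HasCompactSupport.of_support_subset_isCompact isCompact_Icc
    ((subset_tsupport _).trans hws)
  have hwb : ∀ i ≤ N, ∀ t, ‖iteratedDeriv i w t‖ ≤ D * R ^ N * B := fun i hi t =>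
    (hC₁ G θ R (R * c) (S * B) _ hR hG hGb' hθ hθs hθb i hi t).trans_eq (by rw [hD]; ring)
  -- Translating φ by n modulates its kernel by e^{in(x-t)}, leaving a Fourier coefficient of `w` at
  -- frequency n. Replacing log by the smooth `ℓ` is harmless because η vanishes off [1/2, 2].
  have hX : ∫ t, convCheck h u (Real.log t + c) * η t * check (fun t => φ (t - n)) (x - t) =
      Complex.exp (Complex.I * n * x) * ∫ t, w t * Complex.exp (-(Complex.I * (n : ℝ) * t)) := by
    rw [← integral_const_mul]
    congr 1
    ext t
    by_cases ht : t ∈ Icc (1 / 2 : ℝ) 2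
    · have h1 := check_translate φ n (x - t)
      push_cast at h1
      simp only [w, θ]
      rw [hGeq, hlog t ht, mul_add, h1, hκ, Complex.ofReal_intCast]
      have : Complex.exp (Complex.I * n * (x - t)) =
          Complex.exp (Complex.I * n * x) * Complex.exp (-(Complex.I * n * t)) := by
        rw [← Complex.exp_add]
        ring_nf
      rw [this]
      ring
    · have : η t = 0 := image_eq_zero_of_notMem_tsupport fun h => ht (hη.support h)
      simp [w, θ, this]
  have hnorm : ‖Complex.exp (Complex.I * n * x)‖ = 1 := by
    rw [Complex.norm_exp]
    simp
  rw [hX, norm_mul, hnorm, one_mul]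
  set I := ‖∫ t, w t * Complex.exp (-(Complex.I * (n : ℝ) * t))‖ with hI
  -- Here 2 - 1/2 is the length of the interval supporting `w`. Adding the cases i = 0 and i = N
  -- turns |n|^N into (1 + |n|)^N and gives the constant 3.
  have key : ∀ i ≤ N, |(n : ℝ)| ^ i * I ≤ D * R ^ N * B * (2 - 1 / 2) := fun i hi =>
    (pow_mul_norm_integral_mul_exp_le hw hcw i n).trans
      (norm_integral_le_of_tsupport (by norm_num)
        (fun t ht => iteratedDeriv_eq_zero_of_notMem_tsupport (fun h => ht (hws h)) i)
        (hwb i hi))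
  have k0 := key 0 (Nat.zero_le _)
  have kN := key N le_rfl
  have hpow : (1 + |(n : ℝ)|) ^ N ≤ 2 ^ N * (1 + |(n : ℝ)| ^ N) := by
    have h1 := add_pow_le (zero_le_one' ℝ) (abs_nonneg (n : ℝ)) N
    rw [one_pow] at h1
    refine h1.trans (mul_le_mul_of_nonneg_right (pow_le_pow_right₀ one_le_two (Nat.sub_le _ _))
      (by positivity))
  calc (1 + |(n : ℝ)|) ^ N * I ≤ 2 ^ N * (1 + |(n : ℝ)| ^ N) * I :=
        mul_le_mul_of_nonneg_right hpow (norm_nonneg _)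
    _ = 2 ^ N * (|(n : ℝ)| ^ 0 * I + |(n : ℝ)| ^ N * I) := by ring
    _ ≤ 2 ^ N * (D * R ^ N * B * (2 - 1 / 2) + D * R ^ N * B * (2 - 1 / 2)) := by gcongr
    _ = 2 ^ N * (3 * D) * R ^ N * B := by ring

end Multiplier

/-! ### The dyadic Fourier partition, reconstruction, and interpolation of exponents. -/

namespace Multiplier

open SchwartzMap Filter Topology

section DyadicFourier

variable {ψ : ℤ → ℝ → ℂ}

theorem IsDyadicFourierPartition.eq_dilate (hψ : IsDyadicFourierPartition ψ) {m : ℤ} (hm : 1 ≤ m) :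
    ψ m = fun t => ψ 1 (((2 : ℝ) ^ (m - 1))⁻¹ * t) := by
  ext t
  rcases hm.eq_or_lt with rfl | hm
  · simp
  · rw [hψ.dilate m (by omega), ← zpow_neg, neg_sub]

theorem IsDyadicFourierPartition.eq_reflect (hψ : IsDyadicFourierPartition ψ) {m : ℤ}
    (hm : m ≤ -1) : ψ m = fun t => ψ (-m) (-t) := funext (hψ.reflect m hm)

theorem IsDyadicFourierPartition.contDiff (hψ : IsDyadicFourierPartition ψ) (m : ℤ) :
    ContDiff ℝ ∞ (ψ m) := by
  have hpos : ∀ m : ℤ, 1 ≤ m → ContDiff ℝ ∞ (ψ m) := fun m hm => by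
    rw [hψ.eq_dilate hm]
    exact hψ.smooth_one.comp (by fun_prop)
  rcases lt_trichotomy m 0 with hm | rfl | hm
  · rw [hψ.eq_reflect (by omega)]
    exact (hpos _ (by omega)).comp contDiff_neg
  · exact hψ.smooth_zero
  · exact hpos m hm

theorem IsDyadicFourierPartition.eq_zero_of_pos (hψ : IsDyadicFourierPartition ψ) {m : ℤ}
    (hm : 1 ≤ m) {t : ℝ} (ht : t ∉ Icc 0 ((2 : ℝ) ^ m)) : ψ m t = 0 := by
  rw [hψ.eq_dilate hm]
  refine image_eq_zero_of_notMem_tsupport fun h => ht ?_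
  have h2 : (0 : ℝ) < (2 : ℝ) ^ (m - 1) := by positivity
  obtain ⟨h1, h3⟩ := hψ.support_one h
  rw [inv_mul_le_iff₀ h2] at h3
  constructor
  · by_contra hneg
    have : ((2 : ℝ) ^ (m - 1))⁻¹ * t < 0 := mul_neg_of_pos_of_neg (by positivity) (by linarith)
    linarith
  · refine h3.trans_eq ?_
    rw [← zpow_add_one₀ two_ne_zero, sub_add_cancel]

theorem IsDyadicFourierPartition.tsupport_subset (hψ : IsDyadicFourierPartition ψ) (m : ℤ) :
    tsupport (ψ m) ⊆ Icc (-(2 : ℝ) ^ |(m : ℝ)|) ((2 : ℝ) ^ |(m : ℝ)|) := by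
  rcases lt_trichotomy m 0 with hm | rfl | hm
  · refine closure_minimal (fun t ht => ?_) isClosed_Icc
    have hcast : (2 : ℝ) ^ |(m : ℝ)| = (2 : ℝ) ^ (-m) := by
      rw [abs_of_neg (by exact_mod_cast hm), ← Real.rpow_intCast]
      push_cast
      rfl
    by_contra h
    apply ht
    rw [hψ.eq_reflect (by omega)]
    refine hψ.eq_zero_of_pos (by omega) fun h' => h ?_
    rw [hcast]
    exact ⟨by linarith [h'.2], by linarith [h'.1, (by positivity : (0 : ℝ) < 2 ^ (-m))]⟩
  · simpa using hψ.support_zero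
  · refine closure_minimal (fun t ht => ?_) isClosed_Icc
    have hcast : (2 : ℝ) ^ |(m : ℝ)| = (2 : ℝ) ^ m := by
      rw [abs_of_pos (by exact_mod_cast hm), ← Real.rpow_intCast]
    by_contra h
    refine ht (hψ.eq_zero_of_pos hm fun h' => h ?_)
    rw [hcast]
    exact ⟨by linarith [h'.1, (by positivity : (0 : ℝ) < 2 ^ m)], h'.2⟩

theorem IsDyadicFourierPartition.hasCompactSupport (hψ : IsDyadicFourierPartition ψ) (m : ℤ) :
    HasCompactSupport (ψ m) := HasCompactSupport.of_support_subset_isCompact isCompact_Icc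
    ((subset_tsupport _).trans (hψ.tsupport_subset m))

/-- The partition sums at 2t and at t have the same tails, because doubling the argument shifts the
index by one; so their initial terms agree as well. -/
theorem IsDyadicFourierPartition.zero_eq (hψ : IsDyadicFourierPartition ψ) (t : ℝ) :
    ψ 0 t = ψ 0 (2 * t) + ψ 1 (2 * t) + ψ (-1) (2 * t) := by
  -- Folding n with -n counts the zeroth term twice, so the folded sum is 1 plus that term.
  have ha := (hψ.sum_eq_one (2 * t)).nat_add_neg
  have hb := (hψ.sum_eq_one t).nat_add_neg
  have ha' := (hasSum_nat_add_iff' 2).2 ha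
  have hb' := (hasSum_nat_add_iff' 1).2 hb
  have hdil : ∀ (k : ℕ) (s : ℝ), ψ ((k + 2 : ℕ) : ℤ) (2 * s) = ψ ((k + 1 : ℕ) : ℤ) s := by
    intro k s
    rw [hψ.eq_dilate (by push_cast; omega), hψ.eq_dilate (m := ((k + 1 : ℕ) : ℤ))
      (by push_cast; omega)]
    have : (((k + 2 : ℕ) : ℤ) - 1) = (((k + 1 : ℕ) : ℤ) - 1) + 1 := by push_cast; ring
    simp only [this]
    rw [zpow_add_one₀ two_ne_zero]
    congr 1
    field_simp
  have heq : (fun k : ℕ => ψ ((k + 2 : ℕ) : ℤ) (2 * t) + ψ (-((k + 2 : ℕ) : ℤ)) (2 * t)) =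
      fun k : ℕ => ψ ((k + 1 : ℕ) : ℤ) t + ψ (-((k + 1 : ℕ) : ℤ)) t := by
    ext k
    rw [hdil, hψ.reflect (-((k + 2 : ℕ) : ℤ)) (by push_cast; omega),
      hψ.reflect (-((k + 1 : ℕ) : ℤ)) (by push_cast; omega), neg_neg, neg_neg, ← hdil k (-t),
      mul_neg]
  rw [heq] at ha'
  have := ha'.unique hb'
  simp only [Finset.sum_range_succ, Finset.sum_range_zero, Nat.cast_zero, Nat.cast_one,
    neg_zero] at this
  linear_combination this

theorem sum_Icc_neg_succ (a : ℤ → ℂ) (M : ℕ) :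
    ∑ m ∈ Finset.Icc (-((M + 1 : ℕ) : ℤ)) ((M + 1 : ℕ) : ℤ), a m =
      (∑ m ∈ Finset.Icc (-(M : ℤ)) M, a m) + a ((M + 1 : ℕ) : ℤ) + a (-((M + 1 : ℕ) : ℤ)) := by
  have h : Finset.Icc (-((M + 1 : ℕ) : ℤ)) ((M + 1 : ℕ) : ℤ) =
      insert (-((M + 1 : ℕ) : ℤ)) (insert ((M + 1 : ℕ) : ℤ) (Finset.Icc (-(M : ℤ)) M)) := by
    ext m
    simp only [Finset.mem_Icc, Finset.mem_insert]
    push_cast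
    omega
  rw [h, Finset.sum_insert, Finset.sum_insert]
  · ring
  · simp
  · simp only [Finset.mem_insert, Finset.mem_Icc]
    push_cast
    omega

/-- Telescoping of the two-scale relation `zero_eq`. Symmetric partial sums are thus dilates of one
function, and their kernels form an approximate identity. -/
theorem IsDyadicFourierPartition.sum_Icc (hψ : IsDyadicFourierPartition ψ) (M : ℕ) (t : ℝ) :
    ∑ m ∈ Finset.Icc (-(M : ℤ)) M, ψ m t = ψ 0 (((2 : ℝ) ^ M)⁻¹ * t) := by
  induction M with
  | zero => simp
  | succ M ih =>
    rw [sum_Icc_neg_succ (fun m => ψ m t), ih, hψ.zero_eq (((2 : ℝ) ^ (M + 1))⁻¹ * t)]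
    have h : 2 * (((2 : ℝ) ^ (M + 1))⁻¹ * t) = ((2 : ℝ) ^ M)⁻¹ * t := by
      rw [pow_succ]
      field_simp
    have h1 : ∀ s, ψ ((M + 1 : ℕ) : ℤ) s = ψ 1 (((2 : ℝ) ^ M)⁻¹ * s) := by
      intro s
      rw [hψ.eq_dilate (by push_cast; omega)]
      simp
    rw [h, h1, hψ.reflect (-((M + 1 : ℕ) : ℤ)) (by push_cast; omega), neg_neg, h1,
      hψ.reflect (-1) le_rfl, neg_neg, mul_neg]

theorem IsDyadicFourierPartition.zero_zero (hψ : IsDyadicFourierPartition ψ) : ψ 0 0 = 1 := by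
  refine (hasSum_single (f := fun m : ℤ => ψ m 0) 0 fun m hm => ?_).unique (hψ.sum_eq_one 0)
  have h1 : ψ 1 0 = 0 := image_eq_zero_of_notMem_tsupport fun h =>
    absurd (hψ.support_one h).1 (by norm_num)
  rcases lt_or_gt_of_ne hm with hm | hm
  · rw [hψ.reflect m (by omega), neg_zero, hψ.eq_dilate (by omega)]
    simpa using h1
  · rw [hψ.eq_dilate (by omega)]
    simpa using h1

/-- The kernel has integral u(0) = 1; after rescaling the integration variable, dominated
convergence applies. -/
theorem tendsto_convCheck_dilate {u F : ℝ → ℂ} (hu : ContDiff ℝ ∞ u) (hc : HasCompactSupport u)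
    (h0 : u 0 = 1) (hF : Continuous F) {K : ℝ} (hK : ∀ x, ‖F x‖ ≤ K) (x : ℝ) :
    Tendsto (fun M : ℕ => convCheck F (fun t => u (((2 : ℝ) ^ M)⁻¹ * t)) x) atTop (𝓝 (F x)) := by
  obtain ⟨κ, hκ⟩ := exists_schwartz_check hu hc
  have h1 : ∀ M : ℕ, convCheck F (fun t => u (((2 : ℝ) ^ M)⁻¹ * t)) x =
      ∫ y, F (x - ((2 : ℝ) ^ M)⁻¹ * y) * κ y := by
    intro M
    have hM : (0 : ℝ) < 2 ^ M := by positivity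
    rw [convCheck_apply]
    simp_rw [check_dilate u hM]
    rw [← integral_sub_left_eq_self _ volume x]
    have h2 := Measure.integral_comp_mul_left
      (fun y => F (x - y) * (((2 ^ M : ℝ) : ℂ) * check u (2 ^ M * (x - (x - y))))) ((2 : ℝ) ^ M)⁻¹
    rw [inv_inv, abs_of_pos hM, Complex.real_smul] at h2
    rw [← mul_right_inj' (by exact_mod_cast hM.ne' : ((2 ^ M : ℝ) : ℂ) ≠ 0), ← h2,
      ← integral_const_mul]
    congr 1
    ext y
    rw [sub_sub_cancel, mul_inv_cancel_left₀ hM.ne', hκ]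
    ring
  simp_rw [h1]
  have h2 : F x = ∫ y, F x * κ y := by
    rw [integral_const_mul, hκ, integral_check hu hc, h0, mul_one]
  rw [h2]
  refine tendsto_integral_of_dominated_convergence (fun y => K * ‖κ y‖)
    (fun M => ((hF.comp (by fun_prop)).mul κ.continuous).aestronglyMeasurable)
    ((κ.integrable (μ := volume)).norm.const_mul K)
    (fun M => Eventually.of_forall fun y => ?_) (Eventually.of_forall fun y => ?_)
  · rw [norm_mul]
    exact mul_le_mul_of_nonneg_right (hK _) (norm_nonneg _)
  · have h3 : Tendsto (fun M : ℕ => ((2 : ℝ) ^ M)⁻¹) atTop (𝓝 0) :=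
      tendsto_inv_atTop_zero.comp (tendsto_pow_atTop_atTop_of_one_lt one_lt_two)
    have h4 : Tendsto (fun M : ℕ => x - ((2 : ℝ) ^ M)⁻¹ * y) atTop (𝓝 x) := by
      simpa using tendsto_const_nhds.sub (h3.mul_const y)
    exact ((hF.tendsto x).comp h4).mul_const _

theorem convCheck_sum {ι : Type*} (s : Finset ι) {h : ℝ → ℂ} (hh : Convolvable h)
    (u : ι → ℝ → ℂ) (hu : ∀ i ∈ s, ContDiff ℝ ∞ (u i)) (hc : ∀ i ∈ s, HasCompactSupport (u i))
    (x : ℝ) : convCheck h (fun t => ∑ i ∈ s, u i t) x = ∑ i ∈ s, convCheck h (u i) x := by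
  simp_rw [convCheck_apply]
  rw [← integral_finsetSum]
  · congr 1
    ext t
    rw [check_sum s u (fun i hi => (hu i hi).continuous) hc, Finset.mul_sum]
  · intro i hi
    obtain ⟨κ, hκ⟩ := exists_schwartz_check (hu i hi) (hc i hi)
    rw [← hκ]
    rcases hh with hi | ⟨hcont, K, hK⟩
    · obtain ⟨C, hC⟩ := exists_norm_schwartz_le κ
      exact hi.mul_bdd (c := C) (κ.continuous.comp (by fun_prop)).aestronglyMeasurable
        (Eventually.of_forall fun t => hC _)
    · exact integrable_bounded_mul_schwartz hcont hK κ x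

/-- Summability gives some limit; the symmetric partial sums, an approximate identity applied to
`F`, identify it. -/
theorem IsDyadicFourierPartition.hasSum_convCheck (hψ : IsDyadicFourierPartition ψ) {F : ℝ → ℂ}
    (hF : Continuous F) {K : ℝ} (hK : ∀ x, ‖F x‖ ≤ K) {x : ℝ}
    (hsum : Summable fun m => convCheck F (ψ m) x) :
    HasSum (fun m => convCheck F (ψ m) x) (F x) := by
  have h1 := hsum.hasSum
  have h2 : Tendsto (fun M : ℕ => ∑ m ∈ Finset.Icc (-(M : ℤ)) M, convCheck F (ψ m) x) atTop
      (𝓝 (F x)) := by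
    refine (tendsto_convCheck_dilate hψ.smooth_zero (hψ.hasCompactSupport 0) hψ.zero_zero hF hK
      x).congr fun M => ?_
    rw [← convCheck_sum _ (Or.inr ⟨hF, K, hK⟩) _ (fun i _ => hψ.contDiff i)
      (fun i _ => hψ.hasCompactSupport i)]
    congr 1
    ext t
    rw [hψ.sum_Icc]
  have h3 : Tendsto (fun M : ℕ => Finset.Icc (-(M : ℤ)) M) atTop atTop := by
    refine tendsto_atTop_finset_of_monotone (fun a b hab => Finset.Icc_subset_Icc (by simpa)
      (by simpa)) fun m => ⟨m.natAbs, ?_⟩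
    rw [Finset.mem_Icc]
    omega
  rwa [tendsto_nhds_unique (h1.comp h3) h2] at h1

end DyadicFourier

/-- Interpolation between orders 0 and N: for y ≤ x the trivial bound suffices; for x ≤ y the
order-N bound does, since the exponent s - N is nonpositive. -/
theorem rpow_mul_le_of_pow_mul_le {x y X D s : ℝ} {N : ℕ} (hx : 0 < x) (hy : 0 < y) (hX : 0 ≤ X)
    (h0 : X ≤ D) (hN : y ^ N * X ≤ D * x ^ N) (hs : 0 ≤ s) (hsN : s ≤ N) :
    y ^ s * X ≤ D * x ^ s := by
  have hD : 0 ≤ D := hX.trans h0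
  rcases le_total y x with h | h
  · rw [mul_comm D]
    exact mul_le_mul (Real.rpow_le_rpow hy.le h hs) h0 hX (by positivity)
  · have h1 : y ^ s = y ^ (s - N) * y ^ N := by
      rw [← Real.rpow_natCast, ← Real.rpow_add hy, sub_add_cancel]
    have h2 : x ^ s = x ^ (s - N) * x ^ N := by
      rw [← Real.rpow_natCast, ← Real.rpow_add hx, sub_add_cancel]
    have h3 : y ^ (s - N) ≤ x ^ (s - N) :=
      Real.rpow_le_rpow_of_nonpos hx h (by linarith)
    calc y ^ s * X = y ^ (s - N) * (y ^ N * X) := by rw [h1]; ring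
      _ ≤ x ^ (s - N) * (D * x ^ N) := by gcongr
      _ = D * x ^ s := by rw [h2]; ring

theorem summable_one_add_abs_rpow {b : ℝ} (hb : 1 < b) :
    Summable fun n : ℤ => (1 + |(n : ℝ)|) ^ (-b) := by
  refine Summable.of_norm_bounded_eventually (Real.summable_abs_int_rpow hb) ?_
  filter_upwards [(finite_singleton (0 : ℤ)).compl_mem_cofinite] with n hn
  have : (0 : ℝ) < |(n : ℝ)| := abs_pos.2 (by exact_mod_cast hn)
  rw [Real.norm_of_nonneg (by positivity)]
  exact Real.rpow_le_rpow_of_nonpos this (by linarith) (by linarith)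

theorem norm_le_toReal_supNorm {h : ℝ → ℂ} (hh : supNorm h ≠ ⊤) (x : ℝ) :
    ‖h x‖ ≤ (supNorm h).toReal := by
  rw [← toReal_enorm]
  exact ENNReal.toReal_mono hh (le_iSup (fun x => ‖h x‖ₑ) x)

theorem supNorm_le_ofReal {h : ℝ → ℂ} {B : ℝ} (hB : ∀ x, ‖h x‖ ≤ B) :
    supNorm h ≤ ENNReal.ofReal B :=
  iSup_le fun x => by
    rw [← ofReal_norm]
    exact ENNReal.ofReal_le_ofReal (hB x)

end Multiplier

/-! ### The first embedding. -/

namespace Multiplier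

open SchwartzMap Filter Topology

theorem IsEquidistantPartition.hasCompactSupport {φ : ℝ → ℂ} (hφ : IsEquidistantPartition φ) :
    HasCompactSupport φ := HasCompactSupport.of_support_subset_isCompact isCompact_Icc
  ((subset_tsupport _).trans hφ.support)

theorem IsDyadicPartition.hasCompactSupport {η : ℝ → ℂ} (hη : IsDyadicPartition η) :
    HasCompactSupport η := HasCompactSupport.of_support_subset_isCompact isCompact_Icc
  ((subset_tsupport _).trans hη.support)

theorem IsDyadicPartition.eq_zero {η : ℝ → ℂ} (hη : IsDyadicPartition η) {t : ℝ}
    (ht : t ∉ Icc (1 / 2 : ℝ) 2) : η t = 0 :=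
  image_eq_zero_of_notMem_tsupport fun h => ht (hη.support h)

theorem IsEquidistantPartition.contDiff_translate {φ : ℝ → ℂ} (hφ : IsEquidistantPartition φ)
    (a : ℝ) : ContDiff ℝ ∞ (fun t => φ (t - a)) := hφ.smooth.comp (by fun_prop)

theorem IsEquidistantPartition.hasCompactSupport_translate {φ : ℝ → ℂ}
    (hφ : IsEquidistantPartition φ) (a : ℝ) : HasCompactSupport (fun t => φ (t - a)) :=
  hφ.hasCompactSupport.comp_homeomorph (Homeomorph.subRight a)

theorem locallyIntegrableOn_of_continuous_expComp {f : ℝ → ℂ} (hf : Continuous (expComp f)) :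
    LocallyIntegrableOn f (Ioi 0) volume := by
  refine ContinuousOn.locallyIntegrableOn ?_ measurableSet_Ioi
  have h1 : ContinuousOn (fun t => expComp f (Real.log t)) (Ioi 0) :=
    hf.comp_continuousOn (Real.continuousOn_log.mono fun t ht => (mem_Ioi.1 ht).ne')
  exact h1.congr fun t ht => by simp only [expComp, Real.exp_log (mem_Ioi.1 ht)]

/-- In the exponential variable, dilation by 2^k is translation by k log 2, to which sup norms are
blind. -/
theorem localDilate_eq {η : ℝ → ℂ} (hη : IsDyadicPartition η) (f : ℝ → ℂ) (k : ℤ) (t : ℝ) :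
    localDilate η f k t = expComp f (Real.log t + k * Real.log 2) * η t := by
  by_cases ht : t ∈ Icc (1 / 2 : ℝ) 2
  · have h0 : 0 < t := by linarith [ht.1]
    simp only [localDilate, expComp]
    rw [Real.exp_add, Real.exp_log h0, mul_comm (k : ℝ), Real.exp_mul, Real.exp_log two_pos,
      Real.rpow_intCast, mul_comm t]
  · simp only [localDilate, hη.eq_zero ht, mul_zero]

/-- The embedding `M^{α+1+ε} ↪ E^α_unif`. -/
theorem exists_eUnifNorm_le {α ε : ℝ} (hα : 0 < α) (hε : 0 < ε)
    {φ : ℝ → ℂ} (hφ : IsEquidistantPartition φ) {η : ℝ → ℂ} (hη : IsDyadicPartition η)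
    {ψ : ℤ → ℝ → ℂ} (hψ : IsDyadicFourierPartition ψ) :
    ∃ C : ℝ≥0, ∀ f ∈ mihlinClass ψ (α + 1 + ε),
      eUnifNorm φ η α f ≤ C * mihlinNorm ψ (α + 1 + ε) f := by
  set s := α + 1 + ε with hs
  have hs0 : 0 ≤ s := by positivity
  obtain ⟨N, hN⟩ := exists_nat_ge s
  -- Orders 0 and N ≥ s are the two endpoints for the interpolation to the real exponent `s`.
  obtain ⟨C₀, hC₀0, hC₀⟩ := exists_localized_bound hφ hη 0
  obtain ⟨C₁, hC₁0, hC₁⟩ := exists_localized_bound hφ hη N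
  set D := max C₀ C₁ with hD
  have hD0 : 0 ≤ D := le_max_of_le_left hC₀0
  have hsumn := summable_one_add_abs_rpow (b := 1 + ε) (by linarith)
  refine ⟨Real.toNNReal ((∑' n : ℤ, (1 + |(n : ℝ)|) ^ (-(1 + ε))) * D), fun f hf => ?_⟩
  obtain ⟨hcont, ⟨K, hK⟩, hfin⟩ := hf
  set F := expComp f with hF
  have hconv : Convolvable F := Or.inr ⟨hcont, K, hK⟩
  set A : ℤ → ℝ≥0∞ := fun m => supNorm (convCheck F (ψ m)) with hA
  have hw : ∀ m : ℤ, (1 : ℝ) ≤ 2 ^ (|(m : ℝ)| * s) := fun m =>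
    Real.one_le_rpow one_le_two (by positivity)
  have hfin' : ∀ m, A m ≠ ⊤ := fun m => by
    have h1 := ENNReal.ne_top_of_tsum_ne_top hfin.ne m
    exact fun h => h1 (by
      change _ * A m = ⊤
      rw [h]
      exact ENNReal.mul_top (ENNReal.ofReal_pos.2 (by positivity)).ne')
  set B : ℤ → ℝ := fun m => (A m).toReal with hB
  have hBb : ∀ m x, ‖convCheck F (ψ m) x‖ ≤ B m := fun m => norm_le_toReal_supNorm (hfin' m)
  have hB0 : ∀ m, 0 ≤ B m := fun m => ENNReal.toReal_nonneg
  have hterm : ∀ m : ℤ, ENNReal.ofReal ((2 : ℝ) ^ (|(m : ℝ)| * s)) * A m =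
      ENNReal.ofReal ((2 : ℝ) ^ (|(m : ℝ)| * s) * B m) := fun m => by
    rw [ENNReal.ofReal_mul (by positivity), ENNReal.ofReal_toReal (hfin' m)]
  have hnorm : mihlinNorm ψ s f =
      ∑' m : ℤ, ENNReal.ofReal ((2 : ℝ) ^ (|(m : ℝ)| * s) * B m) := tsum_congr hterm
  have hsum : Summable fun m : ℤ => (2 : ℝ) ^ (|(m : ℝ)| * s) * B m := by
    have h1 : (∑' m : ℤ, ENNReal.ofReal ((2 : ℝ) ^ (|(m : ℝ)| * s) * B m)) ≠ ⊤ :=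
      hnorm ▸ hfin.ne
    have h2 := ENNReal.summable_toReal h1
    refine h2.congr fun m => ?_
    rw [ENNReal.toReal_ofReal (mul_nonneg (by positivity) (hB0 m))]
  have hsumB : Summable B := hsum.of_nonneg_of_le hB0 fun m =>
    le_mul_of_one_le_left (hB0 m) (hw m)
  set T := ∑' m : ℤ, (2 : ℝ) ^ (|(m : ℝ)| * s) * B m with hT
  have hT0 : 0 ≤ T := tsum_nonneg fun m => mul_nonneg (by positivity) (hB0 m)
  have hnormT : mihlinNorm ψ s f = ENNReal.ofReal T := by
    rw [hnorm, hT, ENNReal.ofReal_tsum_of_nonneg (fun m => mul_nonneg (by positivity) (hB0 m)) hsum]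
  have hFsum : ∀ x, HasSum (fun m => convCheck F (ψ m) x) (F x) := fun x =>
    hψ.hasSum_convCheck hcont hK (Summable.of_norm_bounded hsumB fun m => hBb m x)
  have hcontm : ∀ m, Continuous (convCheck F (ψ m)) := fun m =>
    continuous_convCheck hconv (hψ.contDiff m) (hψ.hasCompactSupport m)
  -- the frequency pieces of the localised dilates
  have hpiece : ∀ (n k : ℤ) (x : ℝ), (1 + |(n : ℝ)|) ^ s *
      ‖convCheck (localDilate η f k) (fun t => φ (t - n)) x‖ ≤ D * T := by
    intro n k x
    obtain ⟨κ, hκ⟩ := exists_schwartz_check (hφ.contDiff_translate n)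
      (hφ.hasCompactSupport_translate n)
    obtain ⟨C, hC⟩ := exists_norm_schwartz_le κ
    have hC0 : 0 ≤ C := (norm_nonneg _).trans (hC 0)
    have hηi : Integrable η := hη.smooth.continuous.integrable_of_hasCompactSupport
      hη.hasCompactSupport
    let X : ℤ → ℝ → ℂ := fun m t =>
      convCheck F (ψ m) (Real.log t + k * Real.log 2) * η t * κ (x - t)
    have hXb : ∀ m t, ‖X m t‖ ≤ B m * (‖η t‖ * C) := fun m t => by
      simp only [X, norm_mul]
      rw [mul_assoc]
      exact mul_le_mul (hBb m _) (mul_le_mul_of_nonneg_left (hC _) (norm_nonneg _))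
        (by positivity) (hB0 m)
    have hbi : ∀ m, Integrable fun t => B m * (‖η t‖ * C) := fun m =>
      (hηi.norm.mul_const C).const_mul (B m)
    have hXi : ∀ m, Integrable (X m) := fun m => by
      refine (hbi m).mono' ?_ (Eventually.of_forall (hXb m))
      refine Measurable.aestronglyMeasurable ?_
      exact (((hcontm m).measurable.comp (Real.measurable_log.add_const _)).mul
        hη.smooth.continuous.measurable).mul
          (κ.continuous.comp (by fun_prop : Continuous fun t => x - t)).measurable
    -- Absolute convergence in L¹ allows the reconstruction of `F` to be convolved term by term.
    have hXs : Summable fun m => ∫ t, ‖X m t‖ := by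
      refine (hsumB.mul_right (∫ t, ‖η t‖ * C)).of_nonneg_of_le
        (fun m => integral_nonneg fun t => norm_nonneg _) fun m => ?_
      rw [← integral_const_mul]
      exact integral_mono (hXi m).norm (hbi m) (hXb m)
    have h1 := hasSum_integral_of_summable_integral_norm hXi hXs
    have h2 : ∫ t, ∑' m, X m t = convCheck (localDilate η f k) (fun t => φ (t - n)) x := by
      rw [convCheck_apply]
      congr 1
      ext t
      rw [localDilate_eq hη, ← hκ]
      exact (((hFsum _).mul_right _).mul_right _).tsum_eq
    rw [h2] at h1
    -- The weight ⟨n⟩^s is exchanged for 2^{|m|s}, exactly the Mihlin weight.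
    have h3 : ∀ m, (1 + |(n : ℝ)|) ^ s * ‖∫ t, X m t‖ ≤
        D * ((2 : ℝ) ^ (|(m : ℝ)| * s) * B m) := by
      intro m
      have hR : (1 : ℝ) ≤ 2 ^ |(m : ℝ)| := Real.one_le_rpow one_le_two (abs_nonneg _)
      have e0 := hC₀ F (ψ m) _ (B m) (k * Real.log 2) hR hconv (hψ.contDiff m)
        (hψ.tsupport_subset m) (hBb m) n x
      have e1 := hC₁ F (ψ m) _ (B m) (k * Real.log 2) hR hconv (hψ.contDiff m)
        (hψ.tsupport_subset m) (hBb m) n x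
      rw [← hκ] at e0 e1
      simp only [pow_zero, one_mul, mul_one] at e0
      have := rpow_mul_le_of_pow_mul_le (x := 2 ^ |(m : ℝ)|) (y := 1 + |(n : ℝ)|)
        (X := ‖∫ t, X m t‖) (D := D * B m) (s := s) (N := N) (by positivity) (by positivity)
        (norm_nonneg _) (e0.trans (mul_le_mul_of_nonneg_right (le_max_left _ _) (hB0 m)))
        (e1.trans (by
          rw [mul_right_comm]
          exact mul_le_mul_of_nonneg_right
            (mul_le_mul_of_nonneg_right (le_max_right _ _) (hB0 m)) (by positivity))) hs0 hN
      refine this.trans_eq ?_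
      rw [← Real.rpow_mul two_pos.le]
      ring
    have h4 : Summable fun m => ‖∫ t, X m t‖ :=
      hXs.of_nonneg_of_le (fun m => norm_nonneg _) fun m => norm_integral_le_integral_norm _
    rw [← h1.tsum_eq]
    calc (1 + |(n : ℝ)|) ^ s * ‖∑' m, ∫ t, X m t‖
        ≤ (1 + |(n : ℝ)|) ^ s * ∑' m, ‖∫ t, X m t‖ :=
          mul_le_mul_of_nonneg_left (norm_tsum_le_tsum_norm h4) (by positivity)
      _ = ∑' m, (1 + |(n : ℝ)|) ^ s * ‖∫ t, X m t‖ := tsum_mul_left.symm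
      _ ≤ ∑' m : ℤ, D * ((2 : ℝ) ^ (|(m : ℝ)| * s) * B m) :=
          (h4.mul_left _).tsum_le_tsum h3 (hsum.mul_left _)
      _ = D * T := by rw [tsum_mul_left]
  -- Since α - s = -(1 + ε), the extra smoothness is spent on summing over n.
  have hsup : ∀ n : ℤ, ENNReal.ofReal ((1 + |(n : ℝ)|) ^ α) *
      ⨆ k : ℤ, supNorm (convCheck (localDilate η f k) (fun t => φ (t - n))) ≤
      ENNReal.ofReal ((1 + |(n : ℝ)|) ^ (-(1 + ε)) * (D * T)) := by
    intro n
    have hn : (0 : ℝ) < 1 + |(n : ℝ)| := by positivity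
    have h1 : (⨆ k : ℤ, supNorm (convCheck (localDilate η f k) (fun t => φ (t - n)))) ≤
        ENNReal.ofReal ((1 + |(n : ℝ)|) ^ (-s) * (D * T)) := by
      refine iSup_le fun k => supNorm_le_ofReal fun x => ?_
      rw [Real.rpow_neg hn.le, inv_mul_eq_div, le_div_iff₀ (by positivity), mul_comm]
      exact hpiece n k x
    refine (mul_le_mul_right h1 _).trans_eq ?_
    rw [← ENNReal.ofReal_mul (by positivity), ← mul_assoc, ← Real.rpow_add hn]
    congr 3
    rw [hs]
    ring
  calc eUnifNorm φ η α f
      ≤ ∑' n : ℤ, ENNReal.ofReal ((1 + |(n : ℝ)|) ^ (-(1 + ε)) * (D * T)) :=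
        ENNReal.tsum_le_tsum hsup
    _ = ENNReal.ofReal ((∑' n : ℤ, (1 + |(n : ℝ)|) ^ (-(1 + ε))) * D * T) := by
        rw [← ENNReal.ofReal_tsum_of_nonneg (fun n => by positivity) (hsumn.mul_right _),
          tsum_mul_right, mul_assoc]
    _ = _ := by
        rw [ENNReal.ofReal_mul (mul_nonneg (tsum_nonneg fun n => by positivity) hD0), hnormT]
        rfl

end Multiplier

/-! ### Bounded overlap of translates, antiderivatives of the dyadic kernels, localised pieces. -/

namespace Multiplier

open SchwartzMap Filter Topology

section Lattice

/-- The indicator function of `[-a, a]`. -/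
noncomputable def near (a y : ℝ) : ℝ := (Icc (-a) a).indicator 1 y

theorem near_nonneg (a y : ℝ) : 0 ≤ near a y := indicator_nonneg (fun _ _ => zero_le_one) y

theorem near_le_one (a y : ℝ) : near a y ≤ 1 := indicator_le_self' (fun _ _ => zero_le_one) y

theorem near_eq_one {a y : ℝ} (h : y ∈ Icc (-a) a) : near a y = 1 := indicator_of_mem h 1

theorem near_eq_zero {a y : ℝ} (h : y ∉ Icc (-a) a) : near a y = 0 := indicator_of_notMem h 1

theorem measurable_near (a : ℝ) : Measurable (near a) :=
  measurable_const.indicator measurableSet_Icc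

/-- The sum counts integers in an interval of length 2a/L. This bounded overlap keeps sums over k
uniform in x. -/
theorem sum_near_le {a L : ℝ} (ha : 0 ≤ a) (hL : 0 < L) (x : ℝ) (S : Finset ℤ) :
    ∑ k ∈ S, near a (x - k * L) ≤ 2 * a / L + 1 := by
  classical
  have h1 : ∑ k ∈ S, near a (x - k * L) =
      ((S.filter fun k : ℤ => x - k * L ∈ Icc (-a) a).card : ℝ) := by
    rw [Finset.card_filter, Nat.cast_sum]
    refine Finset.sum_congr rfl fun k _ => ?_
    split_ifs with h
    · rw [near_eq_one h, Nat.cast_one]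
    · rw [near_eq_zero h, Nat.cast_zero]
  have h2 : (S.filter fun k : ℤ => x - k * L ∈ Icc (-a) a) ⊆
      Finset.Icc ⌈(x - a) / L⌉ ⌊(x + a) / L⌋ := by
    intro k hk
    obtain ⟨h3, h4⟩ := (Finset.mem_filter.1 hk).2
    rw [Finset.mem_Icc, Int.ceil_le, Int.le_floor, div_le_iff₀ hL, le_div_iff₀ hL]
    constructor <;> linarith
  have h3 := Finset.card_le_card h2
  rw [Int.card_Icc] at h3
  rw [h1]
  refine (Nat.cast_le.2 h3).trans ?_
  have h5 : (0 : ℝ) ≤ 2 * a / L + 1 := by positivity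
  have h6 : ((⌊(x + a) / L⌋ + 1 - ⌈(x - a) / L⌉ : ℤ) : ℝ) ≤ 2 * a / L + 1 := by
    push_cast
    have h7 := Int.floor_le ((x + a) / L)
    have h8 := Int.le_ceil ((x - a) / L)
    have h9 : (x + a) / L - (x - a) / L = 2 * a / L := by ring
    linarith
  rcases le_total 0 (⌊(x + a) / L⌋ + 1 - ⌈(x - a) / L⌉) with h | h
  · rw [← Int.toNat_of_nonneg h] at h6
    exact_mod_cast h6
  · rw [Int.toNat_of_nonpos h]
    simpa using h5

theorem summable_near {a L : ℝ} (ha : 0 ≤ a) (hL : 0 < L) (x : ℝ) :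
    Summable fun k : ℤ => near a (x - k * L) :=
  summable_of_sum_le (fun _ => near_nonneg _ _) (sum_near_le ha hL x)

theorem integrable_near_mul {κ : ℝ → ℂ} (hκ : Integrable κ) (a b x : ℝ) :
    Integrable fun t => near a (t - b) * ‖κ (x - t)‖ :=
  (hκ.comp_sub_left x).norm.bdd_mul (c := 1)
    ((measurable_near a).comp (measurable_id.sub_const b)).aestronglyMeasurable
    (Eventually.of_forall fun t => by
      rw [Real.norm_of_nonneg (near_nonneg _ _)]
      exact near_le_one _ _)

theorem sum_integral_near_mul_le {a L : ℝ} (ha : 0 ≤ a) (hL : 0 < L) {κ : ℝ → ℂ}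
    (hκ : Integrable κ) (x : ℝ) (S : Finset ℤ) :
    ∑ k ∈ S, ∫ t, near a (t - k * L) * ‖κ (x - t)‖ ≤ (2 * a / L + 1) * ∫ t, ‖κ t‖ := by
  rw [← integral_finsetSum _ fun (k : ℤ) _ => integrable_near_mul hκ a (k * L) x,
    ← integral_sub_left_eq_self (fun t => ‖κ t‖) volume x, ← integral_const_mul]
  refine integral_mono (integrable_finsetSum _ fun (k : ℤ) _ => integrable_near_mul hκ a (k * L) x)
    ((hκ.comp_sub_left x).norm.const_mul _) fun t => ?_
  simp only
  rw [← Finset.sum_mul]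
  exact mul_le_mul_of_nonneg_right (sum_near_le ha hL t S) (norm_nonneg _)

end Lattice

section Primitive

/-- Dividing by (iξ)^N is harmless because u vanishes near the origin. -/
theorem exists_eq_pow_mul {u : ℝ → ℂ} (hu : ContDiff ℝ ∞ u) (hc : HasCompactSupport u)
    (h0 : (0 : ℝ) ∉ tsupport u) (N : ℕ) : ∃ v : ℝ → ℂ, ContDiff ℝ ∞ v ∧ HasCompactSupport v ∧
      ∀ ξ : ℝ, u ξ = (Complex.I * ξ) ^ N * v ξ := by
  refine ⟨fun ξ => ((Complex.I * ξ) ^ N)⁻¹ * u ξ, ?_, hc.mul_left, fun ξ => ?_⟩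
  · rw [contDiff_iff_contDiffAt]
    intro ξ
    by_cases hξ : ξ = 0
    · have h1 : (fun ξ : ℝ => ((Complex.I * ξ) ^ N)⁻¹ * u ξ) =ᶠ[𝓝 ξ] fun _ => 0 := by
        rw [hξ]
        filter_upwards [(isClosed_tsupport u).isOpen_compl.mem_nhds h0] with s hs
        rw [image_eq_zero_of_notMem_tsupport hs, mul_zero]
      exact contDiffAt_const.congr_of_eventuallyEq h1
    · refine ContDiffAt.mul (ContDiffAt.inv ?_ ?_) hu.contDiffAt
      · exact ((contDiff_const.mul Complex.ofRealCLM.contDiff).pow N).contDiffAt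
      · exact pow_ne_zero _ (mul_ne_zero Complex.I_ne_zero (by exact_mod_cast hξ))
  · by_cases hξ : ξ = 0
    · simp only [hξ, image_eq_zero_of_notMem_tsupport h0, mul_zero]
    · rw [mul_inv_cancel_left₀]
      exact pow_ne_zero _ (mul_ne_zero Complex.I_ne_zero (by exact_mod_cast hξ))

/-- Division by (iξ)^N on the Fourier side is N-fold antidifferentiation. The L¹ norm of a kernel is
invariant under L¹-normalised dilation, so the antiderivative gains exactly r^{-N}. -/
theorem exists_primitive_check_dilate {u : ℝ → ℂ} (hu : ContDiff ℝ ∞ u)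
    (hc : HasCompactSupport u) (h0 : (0 : ℝ) ∉ tsupport u) (N : ℕ) :
    ∃ C : ℝ, 0 ≤ C ∧ ∀ r : ℝ, 0 < r → ∃ μ : 𝓢(ℝ, ℂ),
      check (fun t => u (r⁻¹ * t)) = iteratedDeriv N μ ∧ r ^ N * ∫ t, ‖μ t‖ ≤ C := by
  obtain ⟨v, hv, hcv, huv⟩ := exists_eq_pow_mul hu hc h0 N
  refine ⟨∫ t, ‖check v t‖, integral_nonneg fun t => norm_nonneg _, fun r hr => ?_⟩
  have hr' : (r : ℂ) ≠ 0 := by exact_mod_cast hr.ne'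
  let vr : ℝ → ℂ := fun t => v (r⁻¹ * t)
  have hvr : ContDiff ℝ ∞ vr := hv.comp (by fun_prop)
  have hcvr : HasCompactSupport vr :=
    hcv.comp_homeomorph (Homeomorph.mulLeft₀ r⁻¹ (inv_ne_zero hr.ne'))
  obtain ⟨μ, hμ⟩ := exists_schwartz_check (u := fun t => ((r : ℂ) ^ N)⁻¹ * vr t)
    (contDiff_const.mul hvr) hcvr.mul_left
  have hscale : ∀ x, check (fun t => ((r : ℂ) ^ N)⁻¹ * vr t) x =
      ((r : ℂ) ^ N)⁻¹ * (r * check v (r * x)) := by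
    intro x
    rw [← check_dilate v hr]
    unfold check
    rw [mul_left_comm, ← integral_const_mul (((r : ℂ) ^ N)⁻¹)]
    congr 2
    ext t
    ring
  refine ⟨μ, ?_, ?_⟩
  · rw [hμ, iteratedDeriv_check (hvr.continuous.const_mul _) hcvr.mul_left]
    congr 1
    ext t
    rw [huv]
    push_cast
    simp only [vr]
    rw [mul_pow, mul_pow, mul_pow, inv_pow]
    ring
  · rw [hμ]
    simp_rw [hscale, norm_mul, norm_inv, norm_pow, Complex.norm_real, Real.norm_of_nonneg hr.le]
    rw [integral_const_mul, integral_const_mul,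
      Measure.integral_comp_mul_left (fun x => ‖check v x‖) r, abs_of_pos (inv_pos.2 hr),
      smul_eq_mul]
    refine le_of_eq ?_
    field_simp

theorem IsDyadicFourierPartition.exists_primitive {ψ : ℤ → ℝ → ℂ}
    (hψ : IsDyadicFourierPartition ψ) (N : ℕ) : ∃ C : ℝ, 0 ≤ C ∧ ∀ m : ℤ, m ≠ 0 →
      ∃ μ : 𝓢(ℝ, ℂ), check (ψ m) = iteratedDeriv N μ ∧
        ((2 : ℝ) ^ |(m : ℝ)|) ^ N * ∫ t, ‖μ t‖ ≤ C := by
  have h1 : (0 : ℝ) ∉ tsupport (ψ 1) := fun h => absurd (hψ.support_one h).1 (by norm_num)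
  have h2 : (0 : ℝ) ∉ tsupport (ψ (-1)) := by
    have hsub : tsupport (ψ (-1)) ⊆ Iic (-(1 / 2)) := by
      refine closure_minimal (fun t ht => ?_) isClosed_Iic
      by_contra h
      refine ht ?_
      rw [hψ.reflect (-1) le_rfl, neg_neg]
      refine image_eq_zero_of_notMem_tsupport fun h' => h ?_
      have := (hψ.support_one h').1
      rw [mem_Iic]
      linarith
    exact fun h => absurd (hsub h) (by norm_num)
  obtain ⟨C₁, hC₁, hp⟩ := exists_primitive_check_dilate (hψ.contDiff 1)
    (hψ.hasCompactSupport 1) h1 N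
  obtain ⟨C₂, hC₂, hn⟩ := exists_primitive_check_dilate (hψ.contDiff (-1))
    (hψ.hasCompactSupport (-1)) h2 N
  -- The m-th kernel is the one of index ±1 dilated by 2^(|m|-1), not 2^|m|; the factor 2^N
  -- compensates.
  refine ⟨2 ^ N * max C₁ C₂, by positivity, fun m hm => ?_⟩
  have hr : (0 : ℝ) < 2 ^ (|m| - 1) := by positivity
  have hscale : ∀ I C : ℝ, C ≤ max C₁ C₂ → ((2 : ℝ) ^ (|m| - 1)) ^ N * I ≤ C →
      ((2 : ℝ) ^ |(m : ℝ)|) ^ N * I ≤ 2 ^ N * max C₁ C₂ := by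
    intro I C hC hI
    have h3 : (2 : ℝ) ^ |(m : ℝ)| = 2 * 2 ^ (|m| - 1) := by
      rw [← Int.cast_abs, Real.rpow_intCast, ← zpow_one_add₀ two_ne_zero, add_sub_cancel]
    rw [h3, mul_pow, mul_assoc]
    exact mul_le_mul_of_nonneg_left (hI.trans hC) (by positivity)
  rcases lt_or_gt_of_ne hm with hm | hm
  · obtain ⟨μ, hμ, hb⟩ := hn _ hr
    refine ⟨μ, ?_, hscale _ _ (le_max_right _ _) hb⟩
    rw [← hμ]
    congr 1
    ext t
    rw [hψ.reflect m (by omega), hψ.eq_dilate (by omega), hψ.reflect (-1) le_rfl, neg_neg,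
      abs_of_neg hm]
    simp only [mul_neg]
  · obtain ⟨μ, hμ, hb⟩ := hp _ hr
    refine ⟨μ, ?_, hscale _ _ (le_max_left _ _) hb⟩
    rw [← hμ, hψ.eq_dilate (m := m) (by omega), abs_of_pos hm]

theorem IsDyadicFourierPartition.exists_integral_norm_check_le {ψ : ℤ → ℝ → ℂ}
    (hψ : IsDyadicFourierPartition ψ) : ∃ C : ℝ, 0 ≤ C ∧ ∀ m, ∫ t, ‖check (ψ m) t‖ ≤ C := by
  obtain ⟨C, hC, h⟩ := hψ.exists_primitive 0
  refine ⟨max C (∫ t, ‖check (ψ 0) t‖), le_max_of_le_left hC, fun m => ?_⟩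
  rcases eq_or_ne m 0 with rfl | hm
  · exact le_max_right _ _
  · obtain ⟨μ, hμ, hb⟩ := h m hm
    rw [hμ, iteratedDeriv_zero]
    exact le_max_of_le_left (by simpa using hb)

/-- Integration by parts, obtained by differentiating the commutative convolution on either factor.
-/
theorem conv_iteratedDeriv_comm {Q : ℝ → ℂ} (hQ : ContDiff ℝ ∞ Q) (hc : HasCompactSupport Q)
    (μ : 𝓢(ℝ, ℂ)) (N : ℕ) (x : ℝ) : ∫ t, Q t * iteratedDeriv N μ (x - t) =
      ∫ t, iteratedDeriv N Q t * μ (x - t) := by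
  let q := hc.toSchwartzMap hQ
  have hq : ⇑q = Q := rfl
  obtain ⟨K, hK⟩ := exists_norm_schwartz_le q
  obtain ⟨K', hK'⟩ := exists_norm_schwartz_le μ
  have h1 := congrFun (iteratedDeriv_conv_schwartz q.continuous hK μ N) x
  have h2 := congrFun (iteratedDeriv_conv_schwartz μ.continuous hK' q N) x
  have h3 : (fun x => ∫ t, q t * μ (x - t)) = fun x => ∫ t, μ t * q (x - t) := by
    ext x
    rw [← integral_sub_left_eq_self _ volume x]
    congr 1
    ext t
    rw [sub_sub_cancel, mul_comm]
  rw [h3, h2, hq] at h1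
  rw [← h1, ← integral_sub_left_eq_self _ volume x]
  congr 1
  ext t
  rw [sub_sub_cancel, mul_comm]

end Primitive

section ExpPiece

/-- The localisation of `p(eˢ)` to `|s| ≤ 2`. -/
noncomputable def expPiece (p : ℝ → ℂ) (s : ℝ) : ℂ := p (Real.exp s) * cutoff s

theorem tsupport_cutoff_subset : tsupport (fun t => (cutoff t : ℂ)) ⊆ Icc (-2) 2 :=
  closure_minimal (fun t ht => by
    by_contra h
    refine ht ?_
    have h1 : cutoff t = 0 := cutoff_eq_zero (by
      by_contra h'
      rw [not_le, abs_lt] at h'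
      exact h ⟨h'.1.le, h'.2.le⟩)
    simp only [h1, Complex.ofReal_zero]) isClosed_Icc

theorem tsupport_expPiece_subset (p : ℝ → ℂ) : tsupport (expPiece p) ⊆ Icc (-2) 2 :=
  (tsupport_mul_subset_right (f := fun s => p (Real.exp s))).trans tsupport_cutoff_subset

theorem norm_expPiece_le {p : ℝ → ℂ} {B : ℝ} (hB : ∀ x, ‖p x‖ ≤ B) (s : ℝ) :
    ‖expPiece p s‖ ≤ B * near 2 s := by
  by_cases hs : s ∈ Icc (-2 : ℝ) 2
  · rw [near_eq_one hs, mul_one, expPiece, norm_mul, Complex.norm_real,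
      Real.norm_of_nonneg cutoff.nonneg]
    exact (mul_le_of_le_one_right (norm_nonneg _) cutoff.le_one).trans (hB _)
  · rw [near_eq_zero hs, mul_zero,
      image_eq_zero_of_notMem_tsupport fun h => hs (tsupport_expPiece_subset p h), norm_zero]

/-- Bernstein and the chain rule for exp on [-2, 2]. Keeping the indicator in the bound preserves
the localisation needed for summing over k. -/
theorem exists_expPiece_bound (N : ℕ) : ∃ C : ℝ, 0 ≤ C ∧ ∀ (h u : ℝ → ℂ) (R B : ℝ), 1 ≤ R →
    Convolvable h → ContDiff ℝ ∞ u → tsupport u ⊆ Icc (-R) R → (∀ x, ‖convCheck h u x‖ ≤ B) →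
    ContDiff ℝ ∞ (expPiece (convCheck h u)) ∧
      ∀ s, ‖iteratedDeriv N (expPiece (convCheck h u)) s‖ ≤ C * R ^ N * B * near 2 s := by
  obtain ⟨b, hb0, hb⟩ := exists_bernstein
  obtain ⟨C₁, hC₁0, hC₁⟩ := exists_comp_mul_bound Real.contDiff_exp
    (isCompact_Icc (a := (-2 : ℝ)) (b := 2)) N
  obtain ⟨M, hM0, hM⟩ := exists_iteratedDeriv_bound contDiff_cutoff hasCompactSupport_cutoff N
  set S := ∑ i ∈ Finset.range (N + 1), b i with hS
  have hS0 : 0 ≤ S := Finset.sum_nonneg fun i _ => hb0 i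
  refine ⟨C₁ * S * M, by positivity, fun h u R B hR hh hu hs hB => ?_⟩
  have hB0 : 0 ≤ B := (norm_nonneg _).trans (hB 0)
  obtain ⟨G, hG, hGeq, hGb⟩ := hb h u R B (by linarith) hh hu hs hB
  have hGb' : ∀ i ≤ N, ∀ y, ‖iteratedDeriv i G y‖ ≤ S * B := fun i hi y =>
    (hGb i y).trans (mul_le_mul_of_nonneg_right (Finset.single_le_sum (f := b)
      (fun i _ => hb0 i) (Finset.mem_range.2 (Nat.lt_succ_of_le hi))) hB0)
  have heq : expPiece (convCheck h u) =
      fun s => G (R * Real.exp s + 0) * (cutoff s : ℂ) := by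
    ext s
    rw [expPiece, hGeq, add_zero]
  refine ⟨?_, fun s => ?_⟩
  · rw [heq]
    have h1 : ContDiff ℝ ∞ fun s => G (R * Real.exp s + 0) := by
      have := Real.contDiff_exp (n := ∞)
      fun_prop
    exact h1.mul contDiff_cutoff
  · by_cases hs : s ∈ Icc (-2 : ℝ) 2
    · rw [near_eq_one hs, heq]
      exact (hC₁ G _ R 0 (S * B) M hR hG hGb' contDiff_cutoff tsupport_cutoff_subset hM N le_rfl
        s).trans_eq (by ring)
    · rw [near_eq_zero hs, mul_zero, iteratedDeriv_eq_zero_of_notMem_tsupport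
        fun h' => hs (tsupport_expPiece_subset _ h'), norm_zero]

end ExpPiece

end Multiplier

/-! ### Recovering a function from its equidistant pieces, and synthesis in the exponential
variable. -/

namespace Multiplier

open SchwartzMap Filter Topology

section Recover

theorem integral_mul_convCheck {v h u : ℝ → ℂ} (hv : Integrable v) (hh : Integrable h)
    (hu : ContDiff ℝ ∞ u) (hc : HasCompactSupport u) :
    ∫ x, v x * convCheck h u x = ∫ t, h t * ∫ x, v x * check u (x - t) := by
  obtain ⟨κ, hκ⟩ := exists_schwartz_check hu hc
  obtain ⟨C, hC⟩ := exists_norm_schwartz_le κ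
  have hint : Integrable (Function.uncurry fun x t : ℝ => v x * h t * check u (x - t))
      (volume.prod volume) := by
    rw [← hκ]
    exact (hv.mul_prod hh).mul_bdd (c := C)
      ((κ.continuous.comp (by fun_prop : Continuous fun p : ℝ × ℝ => p.1 - p.2)).aestronglyMeasurable)
      (Eventually.of_forall fun p => hC _)
  calc ∫ x, v x * convCheck h u x = ∫ x, ∫ t, v x * h t * check u (x - t) := by
        congr 1
        ext x
        rw [convCheck_apply, ← integral_const_mul]
        simp_rw [mul_assoc]
    _ = ∫ t, ∫ x, v x * h t * check u (x - t) := integral_integral_swap hint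
    _ = _ := by
        congr 1
        ext t
        rw [← integral_const_mul]
        congr 1
        ext x
        ring

theorem integral_mul_check_sub {v u : ℝ → ℂ} (hv : Integrable v) (hu : Integrable u) (t : ℝ) :
    ∫ x, v x * check u (x - t) =
      ∫ ξ, u ξ * (check v ξ * Complex.exp (-(Complex.I * t * ξ))) := by
  have hint : Integrable (Function.uncurry fun x ξ : ℝ =>
      v x * u ξ * Complex.exp (Complex.I * ξ * ((x - t : ℝ) : ℂ))) (volume.prod volume) :=
    (hv.mul_prod hu).mul_bdd (c := 1)
      (g := fun p : ℝ × ℝ => Complex.exp (Complex.I * p.2 * ((p.1 - t : ℝ) : ℂ))) (by fun_prop)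
      (Eventually.of_forall fun p => by rw [Complex.norm_exp]; simp)
  calc ∫ x, v x * check u (x - t)
      = (2 * (Real.pi : ℂ))⁻¹ * ∫ x, ∫ ξ : ℝ,
          v x * u ξ * Complex.exp (Complex.I * ξ * ((x - t : ℝ) : ℂ)) := by
        rw [← integral_const_mul]
        congr 1
        ext x
        rw [check, mul_left_comm, ← integral_const_mul (v x)]
        congr 2
        ext ξ
        ring
    _ = (2 * (Real.pi : ℂ))⁻¹ * ∫ ξ : ℝ, ∫ x,
          v x * u ξ * Complex.exp (Complex.I * ξ * ((x - t : ℝ) : ℂ)) := by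
        rw [integral_integral_swap hint]
    _ = _ := by
        rw [← integral_const_mul]
        congr 1
        ext ξ
        have h1 : (fun x : ℝ => v x * u ξ * Complex.exp (Complex.I * ξ * ((x - t : ℝ) : ℂ))) =
            fun x : ℝ => (u ξ * Complex.exp (-(Complex.I * t * ξ))) *
              (Complex.exp (Complex.I * x * ξ) * v x) := by
          ext x
          have : Complex.exp (Complex.I * ξ * ((x - t : ℝ) : ℂ)) =
              Complex.exp (-(Complex.I * t * ξ)) * Complex.exp (Complex.I * x * ξ) := by
            rw [← Complex.exp_add]
            push_cast
            ring_nf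
          rw [this]
          ring
        rw [h1, integral_const_mul, check]
        ring

theorem exists_sum_norm_translate_le {φ : ℝ → ℂ} (hφ : IsEquidistantPartition φ) :
    ∃ C : ℝ, 0 ≤ C ∧ ∀ (ξ : ℝ) (S : Finset ℤ), ∑ n ∈ S, ‖φ (ξ - n)‖ ≤ C := by
  obtain ⟨M, hM0, hM⟩ := exists_iteratedDeriv_bound hφ.smooth hφ.hasCompactSupport 0
  refine ⟨M * (2 * 1 / 1 + 1), by positivity, fun ξ S => ?_⟩
  refine le_trans ?_ (mul_le_mul_of_nonneg_left (sum_near_le zero_le_one one_pos ξ S) hM0)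
  rw [Finset.mul_sum]
  refine Finset.sum_le_sum fun n _ => ?_
  rw [mul_one]
  by_cases h : ξ - n ∈ Icc (-1 : ℝ) 1
  · rw [near_eq_one h, mul_one]
    simpa using hM 0 le_rfl (ξ - n)
  · rw [near_eq_zero h, mul_zero, image_eq_zero_of_notMem_tsupport fun h' => h (hφ.support h'),
      norm_zero]

/-- An integrable function whose frequency pieces are summable is almost everywhere the sum of its
frequency pieces. -/
theorem IsEquidistantPartition.ae_eq_tsum_convCheck {φ : ℝ → ℂ} (hφ : IsEquidistantPartition φ)
    {h : ℝ → ℂ} (hh : Integrable h) {A : ℤ → ℝ} (hA : Summable A)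
    (hb : ∀ (n : ℤ) x, ‖convCheck h (fun t => φ (t - n)) x‖ ≤ A n) :
    ∀ᵐ x, h x = ∑' n : ℤ, convCheck h (fun t => φ (t - n)) x := by
  set p : ℤ → ℝ → ℂ := fun n => convCheck h (fun t => φ (t - n)) with hp
  have hpc : ∀ n, Continuous (p n) := fun n => continuous_convCheck (Or.inl hh)
    (hφ.contDiff_translate n) (hφ.hasCompactSupport_translate n)
  have hcont : Continuous fun x => ∑' n, p n x := continuous_tsum hpc hA hb
  obtain ⟨C, hC0, hC⟩ := exists_sum_norm_translate_le hφ
  -- With h only integrable, its piece sum is identified weakly. Moving the kernels onto the test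
  -- function `v` yields `r n`, and these sum to `v` by Fourier inversion and the partition of
  -- unity.
  refine ae_eq_of_integral_contDiff_smul_eq hh.locallyIntegrable hcont.locallyIntegrable
    fun g hg hgc => ?_
  let v : ℝ → ℂ := fun x => (g x : ℂ)
  have hv : ContDiff ℝ ∞ v := Complex.ofRealCLM.contDiff.comp hg
  have hvc : HasCompactSupport v := hgc.comp_left (g := fun x : ℝ => (x : ℂ)) Complex.ofReal_zero
  have hvi : Integrable v := hv.continuous.integrable_of_hasCompactSupport hvc
  obtain ⟨w, hw⟩ := exists_schwartz_check hv hvc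
  let W : ℝ → ℝ → ℂ := fun t ξ => w ξ * Complex.exp (-(Complex.I * t * ξ))
  have hWn : ∀ t ξ, ‖W t ξ‖ = ‖w ξ‖ := fun t ξ => by
    simp only [W]
    rw [norm_mul, Complex.norm_exp]
    simp
  have hWc : ∀ t, Continuous (W t) := fun t => w.continuous.mul (by fun_prop)
  have hWi : ∀ t, Integrable (W t) := fun t =>
    (w.integrable (μ := volume)).mono (hWc t).aestronglyMeasurable
      (Eventually.of_forall fun ξ => (hWn t ξ).le)
  let r : ℤ → ℝ → ℂ := fun n t => ∫ x, v x * check (fun t => φ (t - n)) (x - t)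
  have hφi : ∀ n : ℤ, Integrable fun ξ => φ (ξ - n) := fun n =>
    (hφ.contDiff_translate n).continuous.integrable_of_hasCompactSupport
      (hφ.hasCompactSupport_translate n)
  have hr : ∀ n t, r n t = ∫ ξ, φ (ξ - n) * W t ξ := fun n t => by
    simp only [r, W]
    rw [integral_mul_check_sub hvi (hφi n), hw]
  obtain ⟨Cw, hCw⟩ := exists_norm_schwartz_le w
  have hφWi : ∀ (n : ℤ) t, Integrable fun ξ => φ (ξ - n) * W t ξ := fun n t =>
    (hφi n).mul_bdd (c := Cw) (hWc t).aestronglyMeasurable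
      (Eventually.of_forall fun ξ => (hWn t ξ).le.trans (hCw ξ))
  let a : ℤ → ℝ := fun n => ∫ ξ, ‖φ (ξ - n)‖ * ‖w ξ‖
  have haW : ∀ (n : ℤ) t, ∫ ξ, ‖φ (ξ - n) * W t ξ‖ = a n := fun n t => by
    simp only [a, norm_mul, hWn]
  have hai : ∀ n : ℤ, Integrable fun ξ => ‖φ (ξ - n)‖ * ‖w ξ‖ := fun n =>
    (hφWi n 0).norm.congr (Eventually.of_forall fun ξ => by simp only [norm_mul, hWn])
  have ha0 : ∀ n, 0 ≤ a n := fun n => integral_nonneg fun ξ => by positivity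
  -- Boundedly many translates of φ overlap at each ξ, so the sum is controlled by the L¹ norm of
  -- `w`.
  have ha : Summable a := by
    refine summable_of_sum_le (c := C * ∫ ξ, ‖w ξ‖) ha0 fun S => ?_
    simp only [a]
    rw [← integral_finsetSum _ fun (n : ℤ) _ => hai n, ← integral_const_mul]
    refine integral_mono (integrable_finsetSum _ fun n _ => hai n)
      ((w.integrable (μ := volume)).norm.const_mul _) fun ξ => ?_
    simp only
    rw [← Finset.sum_mul]
    exact mul_le_mul_of_nonneg_right (hC ξ S) (norm_nonneg _)
  have hrb : ∀ n t, ‖r n t‖ ≤ a n := fun n t => by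
    rw [hr, ← haW n t]
    exact norm_integral_le_integral_norm _
  have hrsum : ∀ t, HasSum (fun n => r n t) (v t) := fun t => by
    have h1 := hasSum_integral_of_summable_integral_norm (fun n => hφWi n t)
      (by simp_rw [haW]; exact ha)
    have h2 : ∫ ξ, ∑' n : ℤ, φ (ξ - n) * W t ξ = v t := by
      rw [← integral_check_mul_exp hv hvc t, ← hw]
      congr 1
      ext ξ
      rw [((hφ.sum_eq_one ξ).mul_right (W t ξ)).tsum_eq, one_mul]
    rw [h2] at h1
    simpa only [hr] using h1
  have hrm : ∀ n, Continuous (r n) := fun n => by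
    obtain ⟨κ, hκ⟩ := exists_schwartz_check (hφ.contDiff_translate n)
      (hφ.hasCompactSupport_translate n)
    obtain ⟨c, hc⟩ := exists_norm_schwartz_le κ
    simp only [r]
    rw [← hκ]
    refine continuous_of_dominated (bound := fun x => ‖v x‖ * c)
      (fun t => (hvi.mul_bdd (c := c)
        (κ.continuous.comp (by fun_prop : Continuous fun x => x - t)).aestronglyMeasurable
        (Eventually.of_forall fun x => hc _)).aestronglyMeasurable)
      (fun t => Eventually.of_forall fun x => ?_) (hvi.norm.mul_const c)
      (Eventually.of_forall fun x =>
        continuous_const.mul (κ.continuous.comp (by fun_prop)))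
    rw [norm_mul]
    exact mul_le_mul_of_nonneg_left (hc _) (norm_nonneg _)
  -- both sides are the sum of the pairings of `v` with the pieces
  have hleft : HasSum (fun n => ∫ t, h t * r n t) (∫ t, h t * v t) := by
    have hi : ∀ n, Integrable fun t => h t * r n t := fun n =>
      hh.mul_bdd (c := a n) (hrm n).aestronglyMeasurable (Eventually.of_forall (hrb n))
    have h1 := hasSum_integral_of_summable_integral_norm hi (by
      refine (ha.mul_left (∫ t, ‖h t‖)).of_nonneg_of_le
        (fun n => integral_nonneg fun t => norm_nonneg _) fun n => ?_
      rw [← integral_mul_const]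
      refine integral_mono (hi n).norm (hh.norm.mul_const _) fun t => ?_
      simp only [norm_mul]
      exact mul_le_mul_of_nonneg_left (hrb n t) (norm_nonneg _))
    have h2 : ∫ t, ∑' n, h t * r n t = ∫ t, h t * v t := by
      congr 1
      ext t
      exact ((hrsum t).mul_left (h t)).tsum_eq
    rwa [h2] at h1
  have hright : HasSum (fun n => ∫ x, v x * p n x) (∫ x, v x * ∑' n, p n x) := by
    have hi : ∀ n, Integrable fun x => v x * p n x := fun n =>
      hvi.mul_bdd (c := A n) (hpc n).aestronglyMeasurable (Eventually.of_forall (hb n))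
    have h1 := hasSum_integral_of_summable_integral_norm hi (by
      refine (hA.mul_left (∫ t, ‖v t‖)).of_nonneg_of_le
        (fun n => integral_nonneg fun t => norm_nonneg _) fun n => ?_
      rw [← integral_mul_const]
      refine integral_mono (hi n).norm (hvi.norm.mul_const _) fun t => ?_
      simp only [norm_mul]
      exact mul_le_mul_of_nonneg_left (hb n t) (norm_nonneg _))
    simpa only [tsum_mul_left] using h1
  have hpair : ∀ n, ∫ x, v x * p n x = ∫ t, h t * r n t := fun n =>
    integral_mul_convCheck hvi hh (hφ.contDiff_translate n) (hφ.hasCompactSupport_translate n)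
  simp_rw [hpair] at hright
  have := hleft.unique hright
  simp_rw [Complex.real_smul]
  rw [← this]
  congr 1
  ext t
  exact mul_comm _ _

end Recover

section Synthesis

/-- The dyadic kernel is an N-th derivative; moving it onto the piece costs R^N and leaves an
antiderivative of L¹ norm O(2^{-|m|N}). Bounded overlap then handles the sum over k. The case m = 0
is excluded because that kernel has no such antiderivative. -/
theorem exists_sum_expPiece_conv_le {ψ : ℤ → ℝ → ℂ} (hψ : IsDyadicFourierPartition ψ) {L : ℝ}
    (hL : 0 < L) (N : ℕ) : ∃ D : ℝ, 0 ≤ D ∧ ∀ (h : ℤ → ℝ → ℂ) (u : ℝ → ℂ) (R B : ℝ), 1 ≤ R →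
      (∀ k, Convolvable (h k)) → ContDiff ℝ ∞ u → tsupport u ⊆ Icc (-R) R →
      (∀ k x, ‖convCheck (h k) u x‖ ≤ B) → ∀ (m : ℤ), m ≠ 0 → ∀ (x : ℝ) (S : Finset ℤ),
        ((2 : ℝ) ^ |(m : ℝ)|) ^ N *
          ∑ k ∈ S, ‖∫ t, expPiece (convCheck (h k) u) (t - k * L) * check (ψ m) (x - t)‖ ≤
            D * R ^ N * B := by
  obtain ⟨C, hC0, hC⟩ := exists_expPiece_bound N
  obtain ⟨C', hC'0, hC'⟩ := hψ.exists_primitive N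
  refine ⟨C * ((2 * 2 / L + 1) * C'), by positivity,
    fun h u R B hR hh hu hs hB m hm x S => ?_⟩
  have hB0 : 0 ≤ B := (norm_nonneg _).trans (hB 0 0)
  obtain ⟨μ, hμ, hb⟩ := hC' m hm
  have hμi : Integrable μ := μ.integrable
  have hterm : ∀ k : ℤ, ‖∫ t, expPiece (convCheck (h k) u) (t - k * L) * check (ψ m) (x - t)‖ ≤
      C * R ^ N * B * ∫ t, near 2 (t - k * L) * ‖μ (x - t)‖ := by
    intro k
    obtain ⟨hQ, hQb⟩ := hC (h k) u R B hR (hh k) hu hs (hB k)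
    have hQc : HasCompactSupport (expPiece (convCheck (h k) u)) :=
      HasCompactSupport.of_support_subset_isCompact isCompact_Icc
        ((subset_tsupport _).trans (tsupport_expPiece_subset _))
    have h1 : ∫ t, expPiece (convCheck (h k) u) (t - k * L) * check (ψ m) (x - t) =
        ∫ t, iteratedDeriv N (expPiece (convCheck (h k) u)) (t - k * L) * μ (x - t) := by
      have h2 := conv_iteratedDeriv_comm hQ hQc μ N (x - k * L)
      rw [← integral_sub_right_eq_self _ (k * L),
        ← integral_sub_right_eq_self (fun t => iteratedDeriv N _ t * _) (k * L)] at h2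
      simpa only [sub_sub_sub_cancel_right, hμ] using h2
    rw [h1, ← integral_const_mul]
    refine norm_integral_le_of_norm_le ((integrable_near_mul hμi 2 _ x).const_mul _)
      (Eventually.of_forall fun t => ?_)
    rw [norm_mul, ← mul_assoc]
    exact mul_le_mul_of_nonneg_right (hQb _) (norm_nonneg _)
  have hR0 : 0 ≤ R := by linarith
  calc ((2 : ℝ) ^ |(m : ℝ)|) ^ N *
        ∑ k ∈ S, ‖∫ t, expPiece (convCheck (h k) u) (t - k * L) * check (ψ m) (x - t)‖
      ≤ ((2 : ℝ) ^ |(m : ℝ)|) ^ N *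
          ∑ k ∈ S, C * R ^ N * B * ∫ t, near 2 (t - k * L) * ‖μ (x - t)‖ :=
        mul_le_mul_of_nonneg_left (Finset.sum_le_sum fun k _ => hterm k) (by positivity)
    _ ≤ ((2 : ℝ) ^ |(m : ℝ)|) ^ N * (C * R ^ N * B * ((2 * 2 / L + 1) * ∫ t, ‖μ t‖)) := by
        rw [← Finset.mul_sum]
        exact mul_le_mul_of_nonneg_left (mul_le_mul_of_nonneg_left
          (sum_integral_near_mul_le zero_le_two hL hμi x S) (by positivity)) (by positivity)
    _ = C * R ^ N * B * (2 * 2 / L + 1) * (((2 : ℝ) ^ |(m : ℝ)|) ^ N * ∫ t, ‖μ t‖) := by ring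
    _ ≤ C * R ^ N * B * (2 * 2 / L + 1) * C' := mul_le_mul_of_nonneg_left hb (by positivity)
    _ = C * ((2 * 2 / L + 1) * C') * R ^ N * B := by ring

/-- The function `∑_{n,k} p_{k,n}(e^{x - kL}) χ(x - kL)`. -/
noncomputable def expSynthesis (p : ℤ → ℤ → ℝ → ℂ) (L x : ℝ) : ℂ :=
  ∑' i : ℤ × ℤ, expPiece (p i.2 i.1) (x - i.2 * L)

variable {p : ℤ → ℤ → ℝ → ℂ} {A : ℤ → ℝ} {L : ℝ}

theorem summable_mul_near (hA : Summable A) (hA0 : ∀ n, 0 ≤ A n) (hL : 0 < L) {a : ℝ}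
    (ha : 0 ≤ a) (x : ℝ) : Summable fun i : ℤ × ℤ => A i.1 * near a (x - i.2 * L) :=
  hA.mul_of_nonneg (summable_near ha hL x) hA0 fun _ => near_nonneg _ _

theorem summable_expPiece (hA : Summable A) (hA0 : ∀ n, 0 ≤ A n) (hL : 0 < L)
    (hp : ∀ k n x, ‖p k n x‖ ≤ A n) (x : ℝ) :
    Summable fun i : ℤ × ℤ => expPiece (p i.2 i.1) (x - i.2 * L) :=
  Summable.of_norm_bounded (summable_mul_near hA hA0 hL zero_le_two x)
    fun i => norm_expPiece_le (hp i.2 i.1) _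

theorem continuous_expPiece {q : ℝ → ℂ} (hq : Continuous q) : Continuous (expPiece q) :=
  (hq.comp Real.continuous_exp).mul contDiff_cutoff.continuous

theorem continuous_expSynthesis (hA : Summable A) (hA0 : ∀ n, 0 ≤ A n) (hL : 0 < L)
    (hpc : ∀ k n, Continuous (p k n)) (hp : ∀ k n x, ‖p k n x‖ ≤ A n) :
    Continuous (expSynthesis p L) := by
  rw [continuous_iff_continuousAt]
  intro x₀
  refine ContinuousOn.continuousAt (s := Ioo (x₀ - 1) (x₀ + 1)) ?_
    (Ioo_mem_nhds (by linarith) (by linarith))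
  -- Radius 3 = 2 + 1 gives a majorant uniform over the unit neighbourhood of x₀.
  refine continuousOn_tsum (u := fun i : ℤ × ℤ => A i.1 * near 3 (x₀ - i.2 * L))
    (fun i => ((continuous_expPiece (hpc i.2 i.1)).comp (by fun_prop)).continuousOn)
    (summable_mul_near hA hA0 hL (by norm_num) x₀) fun i x hx => ?_
  refine (norm_expPiece_le (hp i.2 i.1) _).trans (mul_le_mul_of_nonneg_left ?_ (hA0 _))
  by_cases h : x - i.2 * L ∈ Icc (-2 : ℝ) 2
  · rw [near_eq_one h, near_eq_one]
    constructor <;> linarith [h.1, h.2, hx.1, hx.2]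
  · rw [near_eq_zero h]
    exact near_nonneg _ _

theorem norm_expSynthesis_le (hA : Summable A) (hA0 : ∀ n, 0 ≤ A n) (hL : 0 < L)
    (hp : ∀ k n x, ‖p k n x‖ ≤ A n) (x : ℝ) :
    ‖expSynthesis p L x‖ ≤ (∑' n, A n) * (2 * 2 / L + 1) := by
  have h1 := summable_mul_near hA hA0 hL zero_le_two x
  refine (tsum_of_norm_bounded h1.hasSum fun i => norm_expPiece_le (hp i.2 i.1) _).trans ?_
  rw [← hA.tsum_mul_tsum (summable_near zero_le_two hL x) h1]
  exact mul_le_mul_of_nonneg_left ((summable_near zero_le_two hL x).tsum_le_of_sum_le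
    (sum_near_le zero_le_two hL x)) (tsum_nonneg hA0)

/-- The bounds `A` serve only to convolve termwise; the size is governed by `E`, which may carry the
decay in m. -/
theorem norm_conv_expSynthesis_le (hA : Summable A) (hA0 : ∀ n, 0 ≤ A n) (hL : 0 < L)
    (hpc : ∀ k n, Continuous (p k n)) (hp : ∀ k n x, ‖p k n x‖ ≤ A n) {u : ℝ → ℂ}
    (hu : ContDiff ℝ ∞ u) (hc : HasCompactSupport u) {E : ℤ → ℝ} (hE : Summable E) (x : ℝ)
    (hb : ∀ (n : ℤ) (S : Finset ℤ),
      ∑ k ∈ S, ‖∫ t, expPiece (p k n) (t - k * L) * check u (x - t)‖ ≤ E n) :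
    ‖convCheck (expSynthesis p L) u x‖ ≤ ∑' n, E n := by
  obtain ⟨κ, hκ⟩ := exists_schwartz_check hu hc
  have hκi : Integrable κ := κ.integrable
  let X : ℤ × ℤ → ℝ → ℂ := fun i t => expPiece (p i.2 i.1) (t - i.2 * L) * κ (x - t)
  have hXb : ∀ i t, ‖X i t‖ ≤ A i.1 * (near 2 (t - i.2 * L) * ‖κ (x - t)‖) := fun i t => by
    simp only [X, norm_mul]
    rw [← mul_assoc]
    exact mul_le_mul_of_nonneg_right (norm_expPiece_le (hp i.2 i.1) _) (norm_nonneg _)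
  have hbi : ∀ i : ℤ × ℤ, Integrable fun t =>
      A i.1 * (near 2 (t - i.2 * L) * ‖κ (x - t)‖) := fun i =>
    (integrable_near_mul hκi 2 (i.2 * L) x).const_mul _
  have hXi : ∀ i, Integrable (X i) := fun i => by
    refine (hbi i).mono' ?_ (Eventually.of_forall (hXb i))
    exact (((continuous_expPiece (hpc i.2 i.1)).comp (by fun_prop)).mul
      (κ.continuous.comp (by fun_prop))).aestronglyMeasurable
  have hz : Summable fun k : ℤ => ∫ t, near 2 (t - k * L) * ‖κ (x - t)‖ :=
    summable_of_sum_le (fun k => integral_nonneg fun t =>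
      mul_nonneg (near_nonneg _ _) (norm_nonneg _)) (sum_integral_near_mul_le zero_le_two hL hκi x)
  have hXs : Summable fun i => ∫ t, ‖X i t‖ := by
    refine (hA.mul_of_nonneg hz hA0 fun k => integral_nonneg fun t =>
      mul_nonneg (near_nonneg _ _) (norm_nonneg _)).of_nonneg_of_le
        (fun i => integral_nonneg fun t => norm_nonneg _) fun i => ?_
    rw [← integral_const_mul]
    exact integral_mono (hXi i).norm (hbi i) (hXb i)
  have h1 := hasSum_integral_of_summable_integral_norm hXi hXs
  have h2 : ∫ t, ∑' i, X i t = convCheck (expSynthesis p L) u x := by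
    rw [convCheck_apply, ← hκ]
    congr 1
    ext t
    exact tsum_mul_right
  have h3 : Summable fun i => ‖∫ t, X i t‖ :=
    hXs.of_nonneg_of_le (fun i => norm_nonneg _) fun i => norm_integral_le_integral_norm _
  rw [← h2, ← h1.tsum_eq]
  refine (norm_tsum_le_tsum_norm h3).trans ?_
  rw [h3.tsum_prod]
  refine h3.prod.tsum_le_tsum (fun n => ?_) hE
  refine (h3.prod_factor n).tsum_le_of_sum_le fun S => ?_
  have := hb n S
  rwa [← hκ] at this

end Synthesis

end Multiplier

/-! ### The second embedding. -/

namespace Multiplier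

open SchwartzMap Filter Topology

theorem IsEquidistantPartition.tsupport_translate_subset {φ : ℝ → ℂ}
    (hφ : IsEquidistantPartition φ) (n : ℤ) :
    tsupport (fun t => φ (t - n)) ⊆ Icc (-(1 + |(n : ℝ)|)) (1 + |(n : ℝ)|) := by
  refine closure_minimal (fun t ht => ?_) isClosed_Icc
  by_contra h
  refine ht (image_eq_zero_of_notMem_tsupport fun h' => h ?_)
  have h1 := hφ.support h'
  constructor
  · linarith [h1.1, neg_abs_le (n : ℝ)]
  · linarith [h1.2, le_abs_self (n : ℝ)]

/-- Only values of f on a compact subset of (0, ∞) enter, so local integrability there suffices even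
without control at 0. -/
theorem integrable_localDilate {η : ℝ → ℂ} (hη : IsDyadicPartition η) {f : ℝ → ℂ}
    (hf : LocallyIntegrableOn f (Ioi 0) volume) (k : ℤ) : Integrable (localDilate η f k) := by
  have h2 : (0 : ℝ) < 2 ^ k := by positivity
  set S : Set ℝ := Icc ((2 : ℝ) ^ k * (1 / 2)) ((2 : ℝ) ^ k * 2) with hS
  have hsub : S ⊆ Ioi 0 := fun t ht => lt_of_lt_of_le (by positivity) ht.1
  have h1 : IntegrableOn f S := (hf.mono_set hsub).integrableOn_isCompact isCompact_Icc
  have h3 : Integrable (fun t => S.indicator f ((2 : ℝ) ^ k * t)) :=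
    ((integrable_indicator_iff measurableSet_Icc).2 h1).comp_mul_left' h2.ne'
  obtain ⟨M, -, hM⟩ := exists_iteratedDeriv_bound hη.smooth hη.hasCompactSupport 0
  refine (h3.mul_bdd (c := M) hη.smooth.continuous.aestronglyMeasurable
    (Eventually.of_forall fun t => by simpa using hM 0 le_rfl t)).congr
      (Eventually.of_forall fun t => ?_)
  by_cases ht : t ∈ Icc (1 / 2 : ℝ) 2
  · have : (2 : ℝ) ^ k * t ∈ S :=
      ⟨mul_le_mul_of_nonneg_left ht.1 h2.le, mul_le_mul_of_nonneg_left ht.2 h2.le⟩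
    simp only [localDilate, indicator_of_mem this]
  · simp only [localDilate, hη.eq_zero ht, mul_zero]

theorem ae_comp_mul_left {P : ℝ → Prop} (h : ∀ᵐ x, P x) {c : ℝ} (hc : c ≠ 0) :
    ∀ᵐ x, P (c * x) := by
  have hq : Measure.QuasiMeasurePreserving (fun x : ℝ => c * x) volume volume :=
    ⟨measurable_const_mul c, by
      rw [Real.map_volume_mul_left hc]
      exact Measure.smul_absolutelyContinuous⟩
  exact hq.ae h

/-- The order-0 endpoint of the interpolation: no smoothness is used, and m = 0 is included. -/
theorem exists_sum_expPiece_conv_le_of_bound {ψ : ℤ → ℝ → ℂ} (hψ : IsDyadicFourierPartition ψ)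
    {L : ℝ} (hL : 0 < L) : ∃ D : ℝ, 0 ≤ D ∧ ∀ (q : ℤ → ℝ → ℂ) (B : ℝ),
      (∀ k x, ‖q k x‖ ≤ B) → ∀ (m : ℤ) (x : ℝ) (S : Finset ℤ),
        ∑ k ∈ S, ‖∫ t, expPiece (q k) (t - k * L) * check (ψ m) (x - t)‖ ≤ D * B := by
  obtain ⟨C, hC0, hC⟩ := hψ.exists_integral_norm_check_le
  refine ⟨(2 * 2 / L + 1) * C, by positivity, fun q B hB m x S => ?_⟩
  have hB0 : 0 ≤ B := (norm_nonneg _).trans (hB 0 0)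
  obtain ⟨κ, hκ⟩ := exists_schwartz_check (hψ.contDiff m) (hψ.hasCompactSupport m)
  have hκi : Integrable κ := κ.integrable
  have hterm : ∀ k : ℤ, ‖∫ t, expPiece (q k) (t - k * L) * check (ψ m) (x - t)‖ ≤
      B * ∫ t, near 2 (t - k * L) * ‖κ (x - t)‖ := by
    intro k
    rw [← integral_const_mul]
    refine norm_integral_le_of_norm_le ((integrable_near_mul hκi 2 _ x).const_mul _)
      (Eventually.of_forall fun t => ?_)
    rw [norm_mul, ← mul_assoc, hκ]
    exact mul_le_mul_of_nonneg_right (norm_expPiece_le (hB k) _) (norm_nonneg _)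
  have hm := hC m
  rw [← hκ] at hm
  calc _ ≤ ∑ k ∈ S, B * ∫ t, near 2 (t - k * L) * ‖κ (x - t)‖ :=
        Finset.sum_le_sum fun k _ => hterm k
    _ ≤ B * ((2 * 2 / L + 1) * ∫ t, ‖κ t‖) := by
        rw [← Finset.mul_sum]
        exact mul_le_mul_of_nonneg_left (sum_integral_near_mul_le zero_le_two hL hκi x S) hB0
    _ ≤ B * ((2 * 2 / L + 1) * C) := by gcongr
    _ = _ := by ring

theorem summable_two_rpow_neg_abs {ε : ℝ} (hε : 0 < ε) :
    Summable fun m : ℤ => (2 : ℝ) ^ (-(|(m : ℝ)| * ε)) := by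
  have h1 : (2 : ℝ) ^ (-ε) < 1 := Real.rpow_lt_one_of_one_lt_of_neg one_lt_two (by linarith)
  have h2 : Summable fun n : ℕ => ((2 : ℝ) ^ (-ε)) ^ n :=
    summable_geometric_of_lt_one (by positivity) h1
  have h3 : ∀ n : ℕ, ((2 : ℝ) ^ (-ε)) ^ n = (2 : ℝ) ^ (-((n : ℝ) * ε)) := fun n => by
    rw [← Real.rpow_natCast, ← Real.rpow_mul two_pos.le]
    congr 1
    ring
  simp_rw [h3] at h2
  refine Summable.of_nat_of_neg ?_ ?_ <;> simpa using h2

/-- On `(0, ∞)`, an element of `E^α_unif` is almost everywhere the synthesis of its pieces. -/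
theorem ae_eq_expSynthesis {φ η : ℝ → ℂ} (hφ : IsEquidistantPartition φ)
    (hη : IsDyadicPartition η) {f : ℝ → ℂ} (hf : LocallyIntegrableOn f (Ioi 0) volume)
    {A : ℤ → ℝ} (hA : Summable A) (hA0 : ∀ n, 0 ≤ A n)
    (hp : ∀ (k n : ℤ) x, ‖convCheck (localDilate η f k) (fun t => φ (t - n)) x‖ ≤ A n) :
    f =ᵐ[volume.restrict (Ioi 0)] fun t => expSynthesis
      (fun k n => convCheck (localDilate η f k) (fun t => φ (t - n))) (Real.log 2)
        (Real.log t) := by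
  have hL : (0 : ℝ) < Real.log 2 := Real.log_pos one_lt_two
  have h1 : ∀ᵐ t : ℝ, ∀ k : ℤ, localDilate η f k ((2 : ℝ) ^ (-k) * t) =
      ∑' n : ℤ, convCheck (localDilate η f k) (fun t => φ (t - n)) ((2 : ℝ) ^ (-k) * t) :=
    ae_all_iff.2 fun k => ae_comp_mul_left
      (hφ.ae_eq_tsum_convCheck (integrable_localDilate hη hf k) hA (hp k)) (by positivity)
  filter_upwards [ae_restrict_of_ae h1, ae_restrict_mem measurableSet_Ioi] with t ht ht0
  rw [mem_Ioi] at ht0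
  have hs := summable_expPiece (p := fun k n =>
    convCheck (localDilate η f k) (fun t => φ (t - n))) hA hA0 hL hp (Real.log t)
  have hlog : ∀ k : ℤ, Real.log t - k * Real.log 2 = Real.log ((2 : ℝ) ^ (-k) * t) := fun k => by
    rw [Real.log_mul (by positivity) ht0.ne', Real.log_zpow]
    push_cast
    ring
  -- The order of summation is swapped so that, for fixed k, the sum over n first rebuilds
  -- f(t)η(2^{-k}t); the dyadic partition then sums over k.
  rw [expSynthesis, ← (Equiv.prodComm ℤ ℤ).tsum_eq]
  have hs' := (Equiv.prodComm ℤ ℤ).summable_iff.2 hs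
  have h2 := hs'.tsum_prod
  simp only [Function.comp_def, Equiv.prodComm_apply, Prod.fst_swap, Prod.snd_swap] at h2 ⊢
  rw [h2]
  have h3 : ∀ k : ℤ, (∑' n : ℤ, expPiece (convCheck (localDilate η f k) (fun t => φ (t - n)))
      (Real.log t - k * Real.log 2)) = f t * η ((2 : ℝ) ^ (-k) * t) := by
    intro k
    have hpos : (0 : ℝ) < (2 : ℝ) ^ (-k) * t := by positivity
    simp only [expPiece]
    rw [tsum_mul_right, hlog k, Real.exp_log hpos, ← ht k, localDilate, ← mul_assoc,
      ← zpow_add₀ two_ne_zero, add_neg_cancel, zpow_zero, one_mul]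
    by_cases hmem : (2 : ℝ) ^ (-k) * t ∈ Icc (1 / 2 : ℝ) 2
    -- On the support of η the logarithm lies in [-log 2, log 2], inside the region where the cutoff
    -- is 1.
    · have hl2 : Real.log 2 ≤ 1 := by linarith [Real.log_two_lt_d9]
      rw [cutoff_eq_one, Complex.ofReal_one, mul_one]
      rw [abs_le]
      constructor
      · have := Real.log_le_log (by norm_num) hmem.1
        rw [one_div, Real.log_inv] at this
        linarith
      · exact (Real.log_le_log hpos hmem.2).trans hl2
    · rw [hη.eq_zero hmem, mul_zero, zero_mul]
  simp_rw [h3]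
  rw [((hη.sum_eq_one t ht0).mul_left (f t)).tsum_eq, mul_one]

/-- The embedding `E^α_unif ↪ M^{α-ε}`. -/
theorem exists_mihlinNorm_le {α ε : ℝ} (hα : 0 < α) (hε : 0 < ε)
    {φ : ℝ → ℂ} (hφ : IsEquidistantPartition φ) {η : ℝ → ℂ} (hη : IsDyadicPartition η)
    {ψ : ℤ → ℝ → ℂ} (hψ : IsDyadicFourierPartition ψ) :
    ∃ C : ℝ≥0, ∀ f ∈ eUnifClass φ η α, ∃ g ∈ mihlinClass ψ (α - ε),
      f =ᵐ[volume.restrict (Ioi 0)] g ∧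
        mihlinNorm ψ (α - ε) g ≤ C * eUnifNorm φ η α f := by
  have hL : (0 : ℝ) < Real.log 2 := Real.log_pos one_lt_two
  obtain ⟨N, hN⟩ := exists_nat_ge α
  obtain ⟨D₀, hD₀0, hD₀⟩ := exists_sum_expPiece_conv_le_of_bound hψ hL
  obtain ⟨D₁, hD₁0, hD₁⟩ := exists_sum_expPiece_conv_le hψ hL N
  set D := max D₀ D₁ with hD
  have hD0 : 0 ≤ D := le_max_of_le_left hD₀0
  have hsumm := summable_two_rpow_neg_abs hε
  refine ⟨Real.toNNReal ((∑' m : ℤ, (2 : ℝ) ^ (-(|(m : ℝ)| * ε))) * D), fun f hf => ?_⟩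
  obtain ⟨hloc, hfin⟩ := hf
  set p : ℤ → ℤ → ℝ → ℂ := fun k n => convCheck (localDilate η f k) (fun t => φ (t - n)) with hp
  have hconv : ∀ k, Convolvable (localDilate η f k) := fun k =>
    Or.inl (integrable_localDilate hη hloc k)
  set a : ℤ → ℝ≥0∞ := fun n => ⨆ k : ℤ, supNorm (p k n) with ha
  have hw : ∀ n : ℤ, (1 : ℝ) ≤ (1 + |(n : ℝ)|) ^ α := fun n =>
    Real.one_le_rpow (le_add_of_nonneg_right (abs_nonneg _)) hα.le
  have hfin' : ∀ n, a n ≠ ⊤ := fun n => by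
    have h1 := ENNReal.ne_top_of_tsum_ne_top hfin.ne n
    exact fun h => h1 (by
      change _ * a n = ⊤
      rw [h]
      exact ENNReal.mul_top (ENNReal.ofReal_pos.2 (by positivity)).ne')
  set A : ℤ → ℝ := fun n => (a n).toReal with hA
  have hA0 : ∀ n, 0 ≤ A n := fun n => ENNReal.toReal_nonneg
  have hpA : ∀ k n x, ‖p k n x‖ ≤ A n := fun k n x => by
    have hle : supNorm (p k n) ≤ a n := le_iSup (fun k => supNorm (p k n)) k
    exact (norm_le_toReal_supNorm (ne_top_of_le_ne_top (hfin' n) hle) x).trans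
      (ENNReal.toReal_mono (hfin' n) hle)
  have hterm : ∀ n : ℤ, ENNReal.ofReal ((1 + |(n : ℝ)|) ^ α) * a n =
      ENNReal.ofReal ((1 + |(n : ℝ)|) ^ α * A n) := fun n => by
    rw [ENNReal.ofReal_mul (by positivity), ENNReal.ofReal_toReal (hfin' n)]
  have hnorm : eUnifNorm φ η α f = ∑' n : ℤ, ENNReal.ofReal ((1 + |(n : ℝ)|) ^ α * A n) :=
    tsum_congr hterm
  have hnn : ∀ n : ℤ, 0 ≤ (1 + |(n : ℝ)|) ^ α * A n := fun n =>
    mul_nonneg (by positivity) (hA0 n)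
  have hsum : Summable fun n : ℤ => (1 + |(n : ℝ)|) ^ α * A n := by
    have h1 : (∑' n : ℤ, ENNReal.ofReal ((1 + |(n : ℝ)|) ^ α * A n)) ≠ ⊤ := hnorm ▸ hfin.ne
    exact (ENNReal.summable_toReal h1).congr fun n => by rw [ENNReal.toReal_ofReal (hnn n)]
  have hsumA : Summable A := hsum.of_nonneg_of_le hA0 fun n =>
    le_mul_of_one_le_left (hA0 n) (hw n)
  set T := ∑' n : ℤ, (1 + |(n : ℝ)|) ^ α * A n with hT
  have hnormT : eUnifNorm φ η α f = ENNReal.ofReal T := by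
    rw [hnorm, hT, ENNReal.ofReal_tsum_of_nonneg hnn hsum]
  have hpc : ∀ k n, Continuous (p k n) := fun k n => continuous_convCheck (hconv k)
    (hφ.contDiff_translate n) (hφ.hasCompactSupport_translate n)
  set G := expSynthesis p (Real.log 2) with hG
  have hGe : expComp (fun t => G (Real.log t)) = G := by
    ext x
    simp only [expComp, Real.log_exp]
  have hGb : ∀ m : ℤ, ENNReal.ofReal ((2 : ℝ) ^ (|(m : ℝ)| * (α - ε))) *
      supNorm (convCheck G (ψ m)) ≤ ENNReal.ofReal ((2 : ℝ) ^ (-(|(m : ℝ)| * ε)) * (D * T)) := by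
    intro m
    have hpiece : ∀ (x : ℝ) (n : ℤ) (S : Finset ℤ),
        ∑ k ∈ S, ‖∫ t, expPiece (p k n) (t - k * Real.log 2) * check (ψ m) (x - t)‖ ≤
          (2 : ℝ) ^ (-(|(m : ℝ)| * α)) * D * ((1 + |(n : ℝ)|) ^ α * A n) := by
      intro x n S
      have hR : (1 : ℝ) ≤ 1 + |(n : ℝ)| := le_add_of_nonneg_right (abs_nonneg _)
      have e0 := hD₀ (fun k => p k n) (A n) (fun k => hpA k n) m x S
      have e0' := e0.trans (mul_le_mul_of_nonneg_right (le_max_left D₀ D₁) (hA0 n))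
      have e1 : ((2 : ℝ) ^ |(m : ℝ)|) ^ N *
          ∑ k ∈ S, ‖∫ t, expPiece (p k n) (t - k * Real.log 2) * check (ψ m) (x - t)‖ ≤
            D * A n * (1 + |(n : ℝ)|) ^ N := by
        -- At m = 0 no decay is required, and the order-0 bound already implies the claim.
        rcases eq_or_ne m 0 with rfl | hm
        · rw [Int.cast_zero, abs_zero, Real.rpow_zero, one_pow, one_mul]
          exact e0'.trans (le_mul_of_one_le_right (mul_nonneg hD0 (hA0 n)) (one_le_pow₀ hR))
        · refine (hD₁ (localDilate η f) _ _ (A n) hR hconv (hφ.contDiff_translate n)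
            (hφ.tsupport_translate_subset n) (fun k => hpA k n) m hm x S).trans ?_
          rw [mul_right_comm]
          exact mul_le_mul_of_nonneg_right
            (mul_le_mul_of_nonneg_right (le_max_right _ _) (hA0 n)) (by positivity)
      -- Compared with the first embedding, the two frequency scales exchange roles.
      have e2 := rpow_mul_le_of_pow_mul_le (x := 1 + |(n : ℝ)|) (y := 2 ^ |(m : ℝ)|)
        (by positivity) (by positivity) (Finset.sum_nonneg fun k _ => norm_nonneg _) e0' e1
        hα.le hN
      rw [← Real.rpow_mul two_pos.le] at e2
      rw [Real.rpow_neg two_pos.le, mul_assoc, inv_mul_eq_div, le_div_iff₀ (by positivity),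
        mul_comm]
      exact e2.trans_eq (by ring)
    have h1 : supNorm (convCheck G (ψ m)) ≤
        ENNReal.ofReal ((2 : ℝ) ^ (-(|(m : ℝ)| * α)) * D * T) :=
      supNorm_le_ofReal fun x => by
        rw [hT, ← tsum_mul_left]
        exact norm_conv_expSynthesis_le hsumA hA0 hL hpc hpA (hψ.contDiff m)
          (hψ.hasCompactSupport m) (hsum.mul_left _) x (hpiece x)
    -- Decay 2^{-|m|α} against the weight 2^{|m|(α-ε)} leaves 2^{-|m|ε}, summable over m.
    refine (mul_le_mul_right h1 _).trans_eq ?_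
    rw [← ENNReal.ofReal_mul (by positivity), ← mul_assoc, ← mul_assoc, ← Real.rpow_add two_pos,
      ← mul_assoc]
    congr 4
    ring
  have hbound : mihlinNorm ψ (α - ε) (fun t => G (Real.log t)) ≤
      Real.toNNReal ((∑' m : ℤ, (2 : ℝ) ^ (-(|(m : ℝ)| * ε))) * D) * eUnifNorm φ η α f := by
    have hT0 : 0 ≤ T := tsum_nonneg hnn
    calc mihlinNorm ψ (α - ε) (fun t => G (Real.log t))
        = besovNorm ψ (α - ε) G := by rw [mihlinNorm, hGe]
      _ ≤ ∑' m : ℤ, ENNReal.ofReal ((2 : ℝ) ^ (-(|(m : ℝ)| * ε)) * (D * T)) :=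
          ENNReal.tsum_le_tsum hGb
      _ = ENNReal.ofReal ((∑' m : ℤ, (2 : ℝ) ^ (-(|(m : ℝ)| * ε))) * D * T) := by
          rw [← ENNReal.ofReal_tsum_of_nonneg (fun m => by positivity) (hsumm.mul_right _),
            tsum_mul_right, mul_assoc]
      _ = _ := by
          rw [ENNReal.ofReal_mul (mul_nonneg (tsum_nonneg fun m => by positivity) hD0), hnormT]
          rfl
  refine ⟨fun t => G (Real.log t), ⟨?_, ?_, ?_⟩,
    ae_eq_expSynthesis hφ hη hloc hsumA hA0 hpA, hbound⟩
  · rw [hGe]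
    exact continuous_expSynthesis hsumA hA0 hL hpc hpA
  · rw [hGe]
    exact ⟨_, norm_expSynthesis_le hsumA hA0 hL hpA⟩
  · exact hbound.trans_lt (ENNReal.mul_lt_top ENNReal.coe_lt_top hfin)

end Multiplier

theorem mainTheorem5 (α ε : ℝ) (hα : 0 < α) (hε : 0 < ε)
    (φ : ℝ → ℂ) (hφ : Multiplier.IsEquidistantPartition φ)
    (η : ℝ → ℂ) (hη : Multiplier.IsDyadicPartition η)
    (ψ : ℤ → ℝ → ℂ) (hψ : Multiplier.IsDyadicFourierPartition ψ) :
    (∃ C : ℝ≥0, ∀ f ∈ Multiplier.mihlinClass ψ (α + 1 + ε),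
      f ∈ Multiplier.eUnifClass φ η α ∧
      Multiplier.eUnifNorm φ η α f ≤ C * Multiplier.mihlinNorm ψ (α + 1 + ε) f) ∧
    (∃ C : ℝ≥0, ∀ f ∈ Multiplier.eUnifClass φ η α,
      ∃ g ∈ Multiplier.mihlinClass ψ (α - ε),
        f =ᵐ[volume.restrict (Ioi 0)] g ∧
        Multiplier.mihlinNorm ψ (α - ε) g ≤ C * Multiplier.eUnifNorm φ η α f) := by
  refine ⟨?_, Multiplier.exists_mihlinNorm_le hα hε hφ hη hψ⟩
  obtain ⟨C, hC⟩ := Multiplier.exists_eUnifNorm_le hα hε hφ hη hψ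
  refine ⟨C, fun f hf => ⟨⟨Multiplier.locallyIntegrableOn_of_continuous_expComp hf.1, ?_⟩, hC f hf⟩⟩
  exact (hC f hf).trans_lt (ENNReal.mul_lt_top ENNReal.coe_lt_top hf.2.2)
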